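/- Graphs are finite undirected multigraphs (parallel edges allowed; in the definitions of degree and of the adjacency matrix $A(G)$ a loop counts twice). A graph is $(p,q)$-semi-regular bipartite with classes $S,T$ if $S,T$ are non-empty and partition the vertex set, every edge joins a vertex of $S$ to a vertex of $T$, each vertex of $S$ has degree $p$ and each vertex of $T$ has degree $q$. The join $G_1\vee G_2$ is the disjoint union of $G_1$ and $G_2$ together with one edge $vw$ for each $v\in V(G_1)$, $w\in V(G_2)$. The Ihara zeta function of $G$ is $Z_G(u)=\prod_{[C]}(1-u^{|C|})^{-1}$ for complex $u$ with $|u|$ sufficiently small, where $[C]$ runs over the equivalence classes, under cyclic rotation, of primitive, backtrackless, tailless closed paths of oriented edges and $|C|$ is the length of $C$. **Theorem 3.2.** Let $G_1$ be a $(q_1,q_2)$-semi-regular bipartite graph with classes of sizes $n_1,n_2$, and $G_2$ a $(q_3,q_4)$-semi-regular bipartite graph with classes of sizes $n_3,n_4$, each having at least one edge. Put $\nu_1=n_1+n_2$, $\nu_2=n_3+n_4$, $\epsilon_1=n_1q_1$, $\epsilon_2=n_3q_3$. Let $\lambda_1\ge\dots\ge\lambda_{k_1}$ and $\mu_1\ge\dots\ge\mu_{k_2}$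 be the positive eigenvalues, with multiplicity, of $A(G_1)$ and $A(G_2)$. Let $$x_1=1+(q_1+\nu_2-1)u^2,\quad x_2=1+(q_2+\nu_2-1)u^2,\quad x_3=1+(q_3+\nu_1-1)u^2,\quad x_4=1+(q_4+\nu_1-1)u^2,$$ $$a_1=\frac{n_3(x_4+uq_3)+n_4(x_3+uq_4)}{x_3x_4-q_3q_4u^2},\qquad a_2=\frac{n_1(x_2+uq_1)+n_2(x_1+uq_2)}{x_1x_2-q_1q_2u^2},$$ $$h(u)=(1-a_1a_2u^2)(x_1x_2-q_1q_2u^2)(x_3x_4-q_3q_4u^2).$$ Then for $G=G_1\vee G_2$ there is $r>0$ such that for all complex $u$ with $|u|<r$ the denominators of $a_1$ and $a_2$ are non-zero, the product defining $Z_G(u)$ converges (unconditionally) to a non-zero value, and $$Z_G(u)^{-1}=(1-u^2)^{\epsilon_1+\epsilon_2+\nu_1\nu_2-\nu_1-\nu_2}\,x_1^{n_1-k_1}x_2^{n_2-k_1}x_3^{n_3-k_2}x_4^{n_4-k_2}\,h(u)\prod_{i=2}^{k_1}(x_1x_2-\lambda_i^2u^2)\prod_{j=2}^{k_2}(x_3x_4-\mu_j^2u^2).$$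 -/

import Mathlib

/-- A multigraph with vertex type `V` and edge type `E`: every edge has an unordered pair of
end vertices.  Parallel edges and loops are allowed.  (A simple graph `G` is the case
`E = G.edgeSet` with `ends` the inclusion into `Sym2 V`.) -/
structure Multigraph (V E : Type*) where
  /-- the unordered pair of ends of an edge -/
  ends : E → Sym2 V

namespace Multigraph

section basic

variable {V E : Type*} (G : Multigraph V E)

/-- The degree of a vertex: the number of incident edges, each loop counting twice. -/
noncomputable def degree (v : V) : ℕ :=
  {e : E | v ∈ G.ends e}.ncard + {e : E | G.ends e = s(v, v)}.ncard

/-- The adjacency matrix: the `(v, w)` entry is the number of edges joining `v` and `w`, each loop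
counting as two edges. -/
noncomputable def adjMatrix [DecidableEq V] : Matrix V V ℝ :=
  Matrix.of fun v w =>
    (if v = w then 2 else 1) * ({e : E | G.ends e = s(v, w)}.ncard : ℝ)

/-- `G` is a `(p, q)`-semi-regular bipartite graph with vertex classes `S` and `T`: these are
non-empty and partition the vertex set, every edge has one end in `S` and the other end in `T`,
every vertex of `S` has degree `p` and every vertex of `T` has degree `q`. -/
structure IsSemiregularBipartite [Fintype V] [DecidableEq V]
    (S T : Finset V) (p q : ℕ) : Prop where
  left_nonempty : S.Nonempty
  right_nonempty : T.Nonempty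
  disjoint : Disjoint S T
  union_eq : S ∪ T = Finset.univ
  ends_mem : ∀ e : E, ∃ v ∈ S, ∃ w ∈ T, G.ends e = s(v, w)
  degree_left : ∀ v ∈ S, G.degree v = p
  degree_right : ∀ w ∈ T, G.degree w = q

end basic

/-- The join: the disjoint union of the two graphs, together with one new edge `vw` for every
vertex `v` of the first and every vertex `w` of the second graph. -/
def join {V₁ E₁ V₂ E₂ : Type*} (G₁ : Multigraph V₁ E₁) (G₂ : Multigraph V₂ E₂) :
    Multigraph (V₁ ⊕ V₂) (E₁ ⊕ E₂ ⊕ (V₁ × V₂)) where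
  ends
    | Sum.inl e => (G₁.ends e).map Sum.inl
    | Sum.inr (Sum.inl e) => (G₂.ends e).map Sum.inr
    | Sum.inr (Sum.inr (v, w)) => s(Sum.inl v, Sum.inr w)

section zeta

variable {V E : Type*} (G : Multigraph V E)

/-- The origin of an oriented edge.  Oriented edges are pairs in `E × Bool`: every edge `e`,
loops included, carries the two orientations `(e, true)` and `(e, false)`, where `(e, true)` points
from the first to the second entry of an arbitrarily chosen ordering of the ends of `e`. -/
noncomputable def origin (a : E × Bool) : V :=
  if a.2 then (Quot.out (G.ends a.1)).1 else (Quot.out (G.ends a.1)).2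

/-- The oriented edge with the opposite orientation. -/
def reverse (a : E × Bool) : E × Bool := (a.1, !a.2)

/-- The terminus of an oriented edge. -/
noncomputable def terminus (a : E × Bool) : V := G.origin (reverse a)

/-- The equivalence classes `[C]` of primitive, backtrackless, tailless closed paths `C`.  A closed
path is a non-empty sequence of oriented edges, each ending where the cyclically next one starts;
two closed paths are equivalent if they differ by a cyclic rotation, so a class is a `Cycle`.
`Cycle.Chain r C` says that `r a b` holds for all cyclically consecutive `a`, `b`; used with
`b ≠ reverse a` it thus excludes backtracks and, through the last and the first edge, tails. -/
structure IsPrimeCycle (C : Cycle (E × Bool)) : Prop where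
  ne_nil : C ≠ Cycle.nil
  closed : C.Chain fun a b => G.terminus a = G.origin b
  backtrackless_tailless : C.Chain fun a b => b ≠ reverse a
  /-- `C` is not a power `P ^ k` with `k ≥ 2` -/
  primitive : ∀ (P : List (E × Bool)) (k : ℕ), 2 ≤ k →
    C ≠ ((List.replicate k P).flatten : List (E × Bool))

/-- The Euler factor `(1 - u ^ |C|)⁻¹` of a class `[C]`. -/
noncomputable def eulerFactor (u : ℂ) (C : {C : Cycle (E × Bool) // G.IsPrimeCycle C}) : ℂ :=
  (1 - u ^ C.1.length)⁻¹

/-- The Ihara zeta function `Z_G(u) = ∏_{[C]} (1 - u ^ |C|)⁻¹`, meaningful where the product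
converges. -/
noncomputable def iharaZeta (u : ℂ) : ℂ := ∏' C, G.eulerFactor u C

end zeta

/-- `lam 1 ≥ lam 2 ≥ ⋯ ≥ lam k` are the positive eigenvalues of the matrix `A`, listed with
multiplicity. -/
def ArePositiveEigenvalues {V : Type*} [Fintype V] [DecidableEq V] (A : Matrix V V ℝ)
    (k : ℕ) (lam : ℕ → ℝ) : Prop :=
  AntitoneOn lam (Set.Icc 1 k) ∧
    (Finset.Icc 1 k).val.map lam = A.charpoly.roots.filter (fun x => 0 < x)

end Multigraph

/-! The zeta function only sees the relation `Follows` on oriented edges. For any relation on a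
finite set with 0-1 matrix `W`, every non-empty closed word is, in exactly one way, a power of a
prime cycle read from some starting position. Hence `∑ tr (W ^ k) u ^ k / k` equals the sum of `-log
(1 - u ^ |C|)` over prime cycles, and exponentiating gives the Euler product `det (1 - u W)⁻¹` near
`0` (`Cycle.eventually_hasProd_prime`). Bass's formula then moves the determinant from oriented
edges to vertices.

For a join the vertex matrix has two diagonal blocks `M`, `N` and constant off-diagonal blocks `-u`.
Its determinant is `det M * det N * (1 - s t u ^ 2)`, with `s`, `t` the entry sums of solutions of
`M y = 1`, `N z = 1` (`det_fromBlocks_const`). Semi-regularity makes `y` and `z` constant on the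
classes, so `s` and `t` come from 2 × 2 systems. Finally `det M` and `det N` factor over the
singular values of the bipartite blocks (`exists_singular_values`). The largest one squares to the
product of the two degrees, by a Perron argument, and its factor goes into `h`. -/

/-! ### Determinants and traces through eigenvalues. -/

open Matrix Polynomial in
theorem Matrix.det_aeval_eq_prod_roots {K n : Type*} [Field K] [IsAlgClosed K] [Fintype n]
    [DecidableEq n] (A : Matrix n n K) (p : K[X]) :
    (aeval A p).det = (A.charpoly.roots.map fun x => p.eval x).prod := by
  have hc : ∀ t : K, (scalar n t - A).det = (A.charpoly.roots.map fun x => t - x).prod := by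
    intro t
    rw [← eval_charpoly, (IsAlgClosed.splits A.charpoly).eval_eq_prod_roots_of_monic
      A.charpoly_monic]
  have hcard : A.charpoly.roots.card = Fintype.card n := by
    rw [← (IsAlgClosed.splits A.charpoly).natDegree_eq_card_roots, charpoly_natDegree_eq_dim]
  -- `p` is a constant times linear factors, and the determinant of a linear factor in `A` is, up to
  -- sign, a value of the characteristic polynomial.
  have hfac := (IsAlgClosed.splits p).eq_prod_roots
  generalize p.roots = s at hfac
  generalize p.leadingCoeff = c at hfac
  subst hfac
  induction s using Multiset.induction_on with
  | empty =>
    simp [algebraMap_eq_diagonal, Pi.algebraMap_def, hcard]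
  | cons a s ih =>
    have h1 : (aeval A (X - C a)).det = (A.charpoly.roots.map fun x => x - a).prod := by
      have h2 : aeval A (X - C a) = -(scalar n a - A) := by
        simp [algebraMap_eq_diagonal, Pi.algebraMap_def]
      rw [h2, det_neg, hc, ← hcard, ← Multiset.card_map (fun x => a - x), ← Multiset.prod_map_neg,
        Multiset.map_map]
      simp
    have h3 : C c * (Multiset.map (fun a => X - C a) (a ::ₘ s)).prod =
        (X - C a) * (C c * (Multiset.map (fun a => X - C a) s).prod) := by
      simp; ring
    rw [h3, map_mul, det_mul, h1, ih, ← Multiset.prod_map_mul]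
    simp

-- The determinant formula for the polynomial `t - X ^ k` evaluates the characteristic polynomial of
-- `A ^ k` at every `t`.
open Matrix Polynomial in
theorem Matrix.trace_pow_eq_sum_roots {K n : Type*} [Field K] [IsAlgClosed K] [Fintype n]
    [DecidableEq n] (A : Matrix n n K) (k : ℕ) :
    (A ^ k).trace = (A.charpoly.roots.map fun x => x ^ k).sum := by
  have h : (A ^ k).charpoly = ((A.charpoly.roots.map fun x => x ^ k).map fun y => X - C y).prod := by
    have : Infinite K := IsAlgClosed.instInfinite
    refine Polynomial.funext fun t => ?_
    have := det_aeval_eq_prod_roots A (C t - X ^ k)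
    rw [eval_charpoly, eval_multiset_prod, Multiset.map_map, Multiset.map_map]
    simpa [algebraMap_eq_diagonal, Pi.algebraMap_def] using this
  rw [trace_eq_sum_roots_charpoly, h, roots_multiset_prod_X_sub_C]

open Matrix Polynomial in
theorem Matrix.det_one_sub_smul_eq_prod_roots {K n : Type*} [Field K] [IsAlgClosed K] [Fintype n]
    [DecidableEq n] (A : Matrix n n K) (u : K) :
    (1 - u • A).det = (A.charpoly.roots.map fun x => 1 - u * x).prod := by
  have := det_aeval_eq_prod_roots A (1 - C u * X)
  simpa [← Algebra.smul_def] using this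

/-- `exp (∑ tr (Aⁿ) uⁿ / n) = det (1 - u A)⁻¹` near `0`. -/
theorem Matrix.eventually_hasSum_trace_pow {n : Type*} [Fintype n] [DecidableEq n]
    (A : Matrix n n ℂ) :
    ∀ᶠ u : ℂ in nhds 0, ∃ s : ℂ, HasSum (fun k : ℕ => (A ^ k).trace * u ^ k / k) s ∧
      Complex.exp s = (1 - u • A).det⁻¹ := by
  -- Each root `a` contributes the Taylor series of `-log (1 - u a)`; the term `k = 0` is a division
  -- by zero, hence `0`.
  have hroots : ∀ m : Multiset ℂ, ∀ᶠ u : ℂ in nhds 0, ∃ s : ℂ,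
      HasSum (fun k : ℕ => (m.map fun x => x ^ k).sum * u ^ k / k) s ∧
      Complex.exp s = ((m.map fun x => 1 - u * x).prod)⁻¹ := by
    intro m
    induction m using Multiset.induction_on with
    | empty => exact Filter.Eventually.of_forall fun u => ⟨0, by simp [hasSum_zero]⟩
    | cons a m ih =>
      have h0 : ∀ᶠ u : ℂ in nhds 0, ‖u * a‖ < 1 := by
        have : Filter.Tendsto (fun u : ℂ => ‖u * a‖) (nhds 0) (nhds ‖(0 : ℂ) * a‖) :=
          (Continuous.tendsto (by fun_prop) _)
        exact this.eventually (gt_mem_nhds (by simp))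
      filter_upwards [ih, h0] with u ⟨s, hs, he⟩ hu
      refine ⟨-Complex.log (1 - u * a) + s, ?_, ?_⟩
      · have := (Complex.hasSum_taylorSeries_neg_log hu).add hs
        refine this.congr_fun fun k => ?_
        simp [mul_pow]
        ring
      · have hne : 1 - u * a ≠ 0 := by
          intro h
          rw [sub_eq_zero] at h
          rw [← h] at hu
          simp at hu
        rw [Complex.exp_add, he, Complex.exp_neg, Complex.exp_log hne]
        simp [mul_comm]
  filter_upwards [hroots A.charpoly.roots] with u ⟨s, hs, he⟩
  refine ⟨s, ?_, ?_⟩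
  · simpa only [trace_pow_eq_sum_roots] using hs
  · rw [he, det_one_sub_smul_eq_prod_roots]

/-! ### Roots of words as minimal periods of the shift. -/

namespace List
variable {α : Type*}

/-- The periodic sequence `l l l ⋯` obtained by repeating the list `l`. -/
def periodicSeq (l : List α) (i : ℕ) : Option α := l[i % l.length]?

/-- The left shift of sequences. -/
def seqShift {β : Type*} (f : ℕ → β) (i : ℕ) : β := f (i + 1)

theorem seqShift_iterate {β : Type*} (f : ℕ → β) (k : ℕ) :
    seqShift^[k] f = fun i => f (i + k) := by
  induction k with
  | zero => rfl
  | succ k ih =>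
    rw [Function.iterate_succ_apply', ih]
    funext i
    simp only [seqShift]
    congr 1
    omega

/-- The least length of a list whose repetition is the repetition of `l`. -/
noncomputable def rootLength (l : List α) : ℕ := Function.minimalPeriod seqShift l.periodicSeq

theorem isPeriodicPt_periodicSeq (l : List α) :
    Function.IsPeriodicPt seqShift l.length l.periodicSeq := by
  rw [Function.IsPeriodicPt, Function.IsFixedPt, seqShift_iterate]
  funext i
  simp [periodicSeq]

theorem rootLength_dvd_length (l : List α) : l.rootLength ∣ l.length :=
  (isPeriodicPt_periodicSeq l).minimalPeriod_dvd

theorem rootLength_pos {l : List α} (hl : l ≠ []) : 0 < l.rootLength :=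
  (isPeriodicPt_periodicSeq l).minimalPeriod_pos (length_pos_of_ne_nil hl)

theorem eq_of_periodicSeq_eq {l l' : List α} (hlen : l.length = l'.length)
    (h : l.periodicSeq = l'.periodicSeq) : l = l' := by
  refine List.ext_getElem? fun i => ?_
  by_cases hi : i < l.length
  · have := congrFun h i
    simpa [periodicSeq, Nat.mod_eq_of_lt hi, Nat.mod_eq_of_lt (hlen ▸ hi)] using this
  · rw [getElem?_eq_none (by omega), getElem?_eq_none (by omega)]

theorem length_flatten_replicate (k : ℕ) (P : List α) :
    (replicate k P).flatten.length = k * P.length := by simp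

theorem getElem?_flatten_replicate (P : List α) (k i : ℕ) (hi : i < k * P.length) :
    (replicate k P).flatten[i]? = P[i % P.length]? := by
  induction k generalizing i with
  | zero => simp at hi
  | succ k ih =>
    rw [replicate_succ, flatten_cons, getElem?_append]
    split_ifs with h
    · rw [Nat.mod_eq_of_lt h]
    · rw [ih _ (by rw [add_mul, one_mul] at hi; omega), ← Nat.mod_eq_sub_mod (by omega)]

theorem periodicSeq_flatten_replicate (P : List α) {k : ℕ} (hk : 0 < k) :
    (replicate k P).flatten.periodicSeq = P.periodicSeq := by
  funext i
  rcases eq_or_ne P [] with rfl | hP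
  · simp [periodicSeq]
  · have := length_pos_of_ne_nil hP
    rw [periodicSeq, length_flatten_replicate,
      getElem?_flatten_replicate _ _ _ (Nat.mod_lt _ (by positivity)), Nat.mod_mul_left_mod,
      periodicSeq]

theorem periodicSeq_rotate (l : List α) (j : ℕ) :
    (l.rotate j).periodicSeq = seqShift^[j] l.periodicSeq := by
  rw [seqShift_iterate]
  funext i
  rcases eq_or_ne l [] with rfl | hl
  · simp [periodicSeq]
  · have := length_pos_of_ne_nil hl
    simp only [periodicSeq, length_rotate]
    rw [getElem?_rotate (Nat.mod_lt _ this), Nat.mod_add_mod]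

theorem rootLength_rotate (l : List α) (j : ℕ) : (l.rotate j).rootLength = l.rootLength := by
  rcases eq_or_ne l [] with rfl | hl
  · simp
  · rw [rootLength, periodicSeq_rotate, Function.minimalPeriod_apply_iterate, rootLength]
    exact Function.mk_mem_periodicPts (length_pos_of_ne_nil hl) (isPeriodicPt_periodicSeq l)

theorem rootLength_flatten_replicate (P : List α) {k : ℕ} (hk : 0 < k) :
    (replicate k P).flatten.rootLength = P.rootLength := by
  rw [rootLength, periodicSeq_flatten_replicate P hk, rootLength]

theorem periodicSeq_take_rootLength {l : List α} (hl : l ≠ []) :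
    (l.take l.rootLength).periodicSeq = l.periodicSeq := by
  have hd := rootLength_pos hl
  have hle := Nat.le_of_dvd (length_pos_of_ne_nil hl) (rootLength_dvd_length l)
  funext i
  have h1 := congrFun (Function.iterate_mod_minimalPeriod_eq
    (f := seqShift) (x := l.periodicSeq) (n := i)) 0
  change (seqShift^[i % l.rootLength] l.periodicSeq) 0 = _ at h1
  rw [seqShift_iterate, seqShift_iterate] at h1
  simp only [zero_add] at h1
  have h2 := Nat.mod_lt i hd
  rw [← h1, periodicSeq, periodicSeq, length_take, min_eq_left hle, getElem?_take, if_pos h2,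
    Nat.mod_eq_of_lt (h2.trans_le hle)]

/-- Both sides have the same length and the same periodic sequence, and these determine a list. -/
theorem flatten_replicate_take_rootLength {l : List α} (hl : l ≠ []) :
    (replicate (l.length / l.rootLength) (l.take l.rootLength)).flatten = l := by
  have hd := rootLength_pos hl
  have hle := Nat.le_of_dvd (length_pos_of_ne_nil hl) (rootLength_dvd_length l)
  refine eq_of_periodicSeq_eq ?_ ?_
  · rw [length_flatten_replicate, length_take, min_eq_left hle,
      Nat.div_mul_cancel (rootLength_dvd_length l)]
  · rw [periodicSeq_flatten_replicate _ (Nat.div_pos hle hd), periodicSeq_take_rootLength hl]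

/-- A non-empty list is not a proper power iff it equals its own root. -/
theorem primitive_iff_rootLength_eq {l : List α} (hl : l ≠ []) :
    (∀ (P : List α) (k : ℕ), 2 ≤ k → l ≠ (replicate k P).flatten) ↔ l.rootLength = l.length := by
  have hd := rootLength_pos hl
  have hn := length_pos_of_ne_nil hl
  constructor
  · intro h
    have h1 := flatten_replicate_take_rootLength hl
    by_contra hne
    obtain ⟨c, hc⟩ := rootLength_dvd_length l
    refine h _ _ ?_ h1.symm
    rw [hc, Nat.mul_div_cancel_left _ hd]
    by_contra hlt
    interval_cases c
    · omega
    · omega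
  · rintro h P k hk rfl
    rw [rootLength_flatten_replicate P (by omega), length_flatten_replicate] at h
    have hP : 0 < P.length := by
      rw [length_flatten_replicate] at hn
      exact Nat.pos_of_ne_zero fun h0 => by simp [h0] at hn
    have := Nat.le_of_dvd hP (rootLength_dvd_length P)
    nlinarith

/-- Rotations are shifts of the periodic sequence, and shifts by less than the minimal period are
distinct. -/
theorem rotate_injOn_of_rootLength_eq {l : List α} (h : l.rootLength = l.length) {i j : ℕ}
    (hi : i < l.length) (hj : j < l.length) (hij : l.rotate i = l.rotate j) : i = j := by
  refine Function.iterate_injOn_Iio_minimalPeriod (f := seqShift) (x := l.periodicSeq) ?_ ?_ ?_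
  · exact Set.mem_Iio.2 (lt_of_lt_of_eq hi h.symm)
  · exact Set.mem_Iio.2 (lt_of_lt_of_eq hj h.symm)
  · simp only [← periodicSeq_rotate, hij]

end List

/-! ### Prime cycles and their powers. -/

namespace Cycle
variable {α : Type*}

theorem primitive_iff_rootLength_eq {l : List α} (hl : l ≠ []) :
    (∀ (P : List α) (k : ℕ), 2 ≤ k → (l : Cycle α) ≠ ((List.replicate k P).flatten : List α)) ↔
      l.rootLength = l.length := by
  constructor
  · intro h
    refine (List.primitive_iff_rootLength_eq hl).1 fun P k hk he => h P k hk (congrArg _ he)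
  · intro h P k hk he
    obtain ⟨j, hj⟩ := Cycle.coe_eq_coe.1 he
    have hne : l.rotate j ≠ [] := by simpa using hl
    refine (List.primitive_iff_rootLength_eq hne).2 ?_ P k hk hj
    rw [List.rootLength_rotate, h, List.length_rotate]

/-- Read along the infinite sequence, the condition no longer depends on the length, so it passes
between a word, its powers and its root. -/
theorem chain_coe_iff_periodicSeq (r : α → α → Prop) {l : List α} (hl : l ≠ []) :
    Chain r (l : Cycle α) ↔
      ∀ i, ∀ a ∈ l.periodicSeq i, ∀ b ∈ l.periodicSeq (i + 1), r a b := by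
  obtain ⟨c, t, rfl⟩ := List.exists_cons_of_ne_nil hl
  -- The case `i = length` matters: the appended `c` is the wrap-around value.
  have key : ∀ i, i ≤ (c :: t).length → ((c :: t) ++ [c])[i]? = (c :: t).periodicSeq i := by
    intro i hi
    rcases hi.lt_or_eq with h | rfl
    · rw [List.getElem?_append_left h, List.periodicSeq, Nat.mod_eq_of_lt h]
    · rw [List.getElem?_append_right le_rfl]
      simp [List.periodicSeq]
  rw [chain_coe_cons, ← List.cons_append, List.isChain_iff_getElem]
  constructor
  · intro h i a ha b hb
    set n := (c :: t).length with hn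
    have hlt : i % n < n := Nat.mod_lt _ (by simp [hn])
    have hi1 : (c :: t).periodicSeq (i % n) = (c :: t).periodicSeq i := by
      simp [List.periodicSeq, hn]
    have hi2 : (c :: t).periodicSeq (i % n + 1) = (c :: t).periodicSeq (i + 1) := by
      simp [List.periodicSeq, hn]
    have hlen : ((c :: t) ++ [c]).length = n + 1 := by simp [hn]
    have := h (i % n) (by omega)
    rw [← hi1, ← key _ hlt.le, List.getElem?_eq_getElem (by omega)] at ha
    rw [← hi2, ← key _ hlt, List.getElem?_eq_getElem (by omega)] at hb
    simp only [Option.mem_def, Option.some.injEq] at ha hb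
    rwa [ha, hb] at this
  · intro h i hi
    have hlen : ((c :: t) ++ [c]).length = (c :: t).length + 1 := by simp
    refine h i _ ?_ _ ?_
    · rw [← key _ (by omega), List.getElem?_eq_getElem (by omega)]; rfl
    · rw [← key _ (by omega), List.getElem?_eq_getElem (by omega)]; rfl

/-- A non-empty cycle that is consecutively related by `r` and is not a proper power. -/
structure IsPrime (r : α → α → Prop) (C : Cycle α) : Prop where
  ne_nil : C ≠ Cycle.nil
  chain : C.Chain r
  primitive : ∀ (P : List α) (k : ℕ), 2 ≤ k → C ≠ ((List.replicate k P).flatten : List α)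

variable {r : α → α → Prop}

theorem IsPrime.out_ne_nil {C : Cycle α} (hC : C.IsPrime r) : Quotient.out C ≠ [] := by
  intro h
  refine hC.ne_nil ?_
  rw [← Quotient.out_eq C, h]
  rfl

theorem coe_out (C : Cycle α) : ((Quotient.out C : List α) : Cycle α) = C := Quotient.out_eq C

theorem length_out (C : Cycle α) : (Quotient.out C : List α).length = C.length := by
  conv_rhs => rw [← coe_out C]
  rfl

theorem IsPrime.rootLength_out {C : Cycle α} (hC : C.IsPrime r) :
    (Quotient.out C).rootLength = (Quotient.out C).length := by
  refine (primitive_iff_rootLength_eq hC.out_ne_nil).1 ?_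
  rw [coe_out]
  exact hC.primitive

/-- The closed list that runs `k + 1` times through the prime cycle `C`, starting at position `j`
of a chosen representative. -/
noncomputable def primePower
    (x : Σ C : {C : Cycle α // C.IsPrime r}, ℕ × Fin C.1.length) : List α :=
  (List.replicate (x.2.1 + 1) ((Quotient.out x.1.1).rotate x.2.2)).flatten

theorem length_primePower (x : Σ C : {C : Cycle α // C.IsPrime r}, ℕ × Fin C.1.length) :
    (primePower x).length = (x.2.1 + 1) * x.1.1.length := by
  rw [primePower, List.length_flatten_replicate, List.length_rotate, length_out]

theorem IsPrime.length_pos {C : Cycle α} (hC : C.IsPrime r) : 0 < C.length := by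
  rw [← length_out]
  exact List.length_pos_of_ne_nil hC.out_ne_nil

theorem primePower_ne_nil (x : Σ C : {C : Cycle α // C.IsPrime r}, ℕ × Fin C.1.length) :
    primePower x ≠ [] := by
  rw [← List.length_pos_iff, length_primePower]
  have := x.1.2.length_pos
  positivity

theorem chain_primePower (x : Σ C : {C : Cycle α // C.IsPrime r}, ℕ × Fin C.1.length) :
    Chain r (primePower x : Cycle α) := by
  have h1 : (Quotient.out x.1.1).rotate x.2.2 ≠ [] := by
    simpa using x.1.2.out_ne_nil
  rw [chain_coe_iff_periodicSeq r (primePower_ne_nil x), primePower,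
    List.periodicSeq_flatten_replicate _ (Nat.succ_pos _), ← chain_coe_iff_periodicSeq r h1]
  have h2 : (((Quotient.out x.1.1).rotate x.2.2 : List α) : Cycle α) = x.1.1 := by
    conv_rhs => rw [← coe_out x.1.1]
    exact Cycle.coe_eq_coe.2 (List.IsRotated.forall _ _)
  rw [h2]
  exact x.1.2.chain

/-- Equal powers have equal periodic sequences, hence equal roots. The root gives the cycle, the
length gives the exponent, and primitivity gives the position. -/
theorem primePower_injective : Function.Injective (primePower (r := r)) := by
  rintro ⟨⟨C, hC⟩, k, j⟩ ⟨⟨C', hC'⟩, k', j'⟩ h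
  have hj := j.2
  have hj' := j'.2
  have hlen := congrArg List.length h
  rw [length_primePower, length_primePower] at hlen
  simp only [primePower] at h hlen hj hj'
  have hseq := congrArg List.periodicSeq h
  rw [List.periodicSeq_flatten_replicate _ (Nat.succ_pos _),
    List.periodicSeq_flatten_replicate _ (Nat.succ_pos _)] at hseq
  have hroot : ((Quotient.out C).rotate j).rootLength = ((Quotient.out C').rotate j').rootLength := by
    rw [List.rootLength, hseq, List.rootLength]
  rw [List.rootLength_rotate, List.rootLength_rotate, hC.rootLength_out, hC'.rootLength_out] at hroot
  have heq := List.eq_of_periodicSeq_eq (by simpa using hroot) hseq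
  have hCC : C = C' := by
    rw [← coe_out C, ← coe_out C', Cycle.coe_eq_coe]
    exact ((List.IsRotated.forall _ j).symm.trans (heq ▸ List.IsRotated.refl _)).trans
      (List.IsRotated.forall _ j')
  subst hCC
  have hk : k = k' := by
    have := Nat.eq_of_mul_eq_mul_right hC.length_pos hlen
    omega
  have hjj : j = j' := Fin.ext <|
    List.rotate_injOn_of_rootLength_eq hC.rootLength_out (by rwa [length_out])
      (by rwa [length_out]) heq
  rw [hk, hjj]

/-- The first `rootLength` letters form a primitive word with the same periodic sequence, so it
inherits the chain condition. The position `j` corrects for `Quotient.out` choosing some other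
rotation. -/
theorem exists_primePower_eq {l : List α} (hl : l ≠ []) (hc : Chain r (l : Cycle α)) :
    ∃ x, primePower (r := r) x = l := by
  have hd := List.rootLength_pos hl
  have hle := Nat.le_of_dvd (List.length_pos_of_ne_nil hl) (List.rootLength_dvd_length l)
  set P := l.take l.rootLength with hP
  have hPlen : P.length = l.rootLength := by simp [hP, hle]
  have hPne : P ≠ [] := by
    rw [← List.length_pos_iff, hPlen]; exact hd
  have hPseq := List.periodicSeq_take_rootLength hl
  have hprime : IsPrime r (P : Cycle α) := by
    refine ⟨by simpa using hPne, ?_, ?_⟩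
    · rw [chain_coe_iff_periodicSeq r hPne, hPseq, ← chain_coe_iff_periodicSeq r hl]
      exact hc
    · rw [primitive_iff_rootLength_eq hPne, hPlen, List.rootLength, hPseq, List.rootLength]
  have hrot : Quotient.out (P : Cycle α) ~r P := Cycle.coe_eq_coe.1 (coe_out _)
  have hne : Quotient.out (P : Cycle α) ≠ [] := hprime.out_ne_nil
  obtain ⟨j, hj⟩ := hrot
  have hlen := length_out (P : Cycle α)
  have hpos := hprime.length_pos
  refine ⟨⟨⟨P, hprime⟩, l.length / l.rootLength - 1,
    ⟨j % (P : Cycle α).length, Nat.mod_lt _ hpos⟩⟩, ?_⟩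
  have h1 : 0 < l.length / l.rootLength := Nat.div_pos hle hd
  simp only [primePower]
  rw [Nat.sub_add_cancel h1, ← hlen, List.rotate_mod, hj]
  exact List.flatten_replicate_take_rootLength hl

end Cycle

/-! ### Counting closed words by traces. -/

namespace Matrix
variable {α : Type*} [Fintype α] [DecidableEq α]

/-- The 0-1 matrix of a relation. -/
noncomputable def ofRel (r : α → α → Prop) : Matrix α α ℂ :=
  open Classical in Matrix.of fun a b => if r a b then 1 else 0

open Classical in
theorem ofRel_pow_apply (r : α → α → Prop) (n : ℕ) (a b : α) :
    (ofRel r ^ (n + 1)) a b =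
      ∑ f : Fin n → α, if (a :: (List.ofFn f ++ [b])).IsChain r then (1 : ℂ) else 0 := by
  induction n generalizing a with
  | zero => simp [ofRel]
  | succ n ih =>
    rw [pow_succ', mul_apply, ← (Fin.consEquiv fun _ => α).sum_comp, Fintype.sum_prod_type]
    refine Finset.sum_congr rfl fun c _ => ?_
    rw [ih, Finset.mul_sum]
    refine Finset.sum_congr rfl fun f _ => ?_
    simp [ofRel, Fin.consEquiv, List.ofFn_succ, ← ite_and, and_comm]

-- For `n = 0` this would fail: the trace is the cardinality of `α`, but there is only one empty
-- word.
open Classical in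
theorem trace_ofRel_pow (r : α → α → Prop) {n : ℕ} (hn : n ≠ 0) :
    (ofRel r ^ n).trace =
      ∑ f : Fin n → α, if Cycle.Chain r (List.ofFn f : Cycle α) then (1 : ℂ) else 0 := by
  obtain ⟨n, rfl⟩ := Nat.exists_eq_add_one_of_ne_zero hn
  rw [trace, ← (Fin.consEquiv fun _ => α).sum_comp, Fintype.sum_prod_type]
  refine Finset.sum_congr rfl fun a _ => ?_
  rw [diag_apply, ofRel_pow_apply]
  refine Finset.sum_congr rfl fun f _ => ?_
  simp [Fin.consEquiv, List.ofFn_succ]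

end Matrix

/-! ### The Euler product of a finite relation. -/

namespace Cycle
variable {α : Type*} [Fintype α]

/-- Grouping words by length gives a geometric series. This absolute convergence licenses the later
regroupings. -/
theorem summable_list_norm_pow {x : ℝ} (hx : 0 ≤ x) (h : Fintype.card α * x < 1) :
    Summable fun l : List α => x ^ l.length := by
  rw [← List.equivSigmaTuple.symm.summable_iff]
  refine (summable_sigma_of_nonneg fun y => by simp; positivity).2 ⟨fun n => ?_, ?_⟩
  · exact (hasSum_fintype _).summable
  · have : ∀ n, (∑' f : Fin n → α, ((fun l : List α => x ^ l.length) ∘ List.equivSigmaTuple.symm)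
        ⟨n, f⟩) = (Fintype.card α * x) ^ n := by
      intro n
      simp [List.equivSigmaTuple, tsum_fintype, mul_pow]
    simp only [this]
    exact summable_geometric_of_lt_one (by positivity) h

variable [DecidableEq α]

open Classical in
/-- The exponent of the zeta function of `r` as a sum over closed lists. -/
theorem hasSum_closed_lists (r : α → α → Prop) {u s : ℂ} (hu : Fintype.card α * ‖u‖ < 1)
    (hs : HasSum (fun k : ℕ => (Matrix.ofRel r ^ k).trace * u ^ k / k) s) :
    HasSum (fun l : List α =>
      if Chain r (l : Cycle α) then u ^ l.length / l.length else 0) s := by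
  have hsum : Summable (fun l : List α =>
      if Chain r (l : Cycle α) then u ^ l.length / (l.length : ℂ) else 0) := by
    refine Summable.of_norm_bounded (summable_list_norm_pow (norm_nonneg u) hu) fun l => ?_
    split_ifs
    · rw [norm_div, norm_pow, Complex.norm_natCast]
      rcases Nat.eq_zero_or_pos l.length with h | h
      · simp [h]
      · exact div_le_self (by positivity) (by exact_mod_cast h)
    · simp
  have h1 := List.equivSigmaTuple.symm.hasSum_iff.2 hsum.hasSum
  have h2 := h1.sigma fun n => hasSum_fintype _
  have h3 := h2.unique (hs.congr_fun fun n => ?_)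
  · rw [← h3]; exact hsum.hasSum
  -- At length `0` both sides vanish through division by zero.
  · rcases eq_or_ne n 0 with rfl | hn
    · simp [List.equivSigmaTuple]
    · rw [Matrix.trace_ofRel_pow r hn, Finset.sum_mul, Finset.sum_div]
      refine Finset.sum_congr rfl fun f _ => ?_
      simp [List.equivSigmaTuple]
      split_ifs <;> simp

/-- The sum over closed lists, collected by their prime roots. -/
theorem hasSum_neg_log_prime (r : α → α → Prop) {u s : ℂ} (hu1 : ‖u‖ < 1)
    (hu : Fintype.card α * ‖u‖ < 1)
    (hs : HasSum (fun k : ℕ => (Matrix.ofRel r ^ k).trace * u ^ k / k) s) :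
    HasSum (fun C : {C : Cycle α // C.IsPrime r} => -Complex.log (1 - u ^ C.1.length)) s := by
  classical
  have h1 := hasSum_closed_lists r hu hs
  have h2 := (primePower_injective (r := r)).hasSum_iff (f := fun l : List α =>
      if Chain r (l : Cycle α) then u ^ l.length / (l.length : ℂ) else 0) (a := s) ?_
  · have h3 := h2.2 h1
    -- A prime cycle of length `d` has `d` starting positions, each of weight `u ^ ((k + 1) d) / ((k
    -- + 1) d)`. The factor `d` cancels and the logarithmic series in `u ^ d` remains.
    have h4 := h3.sigma fun C => (h3.summable.sigma_factor C).hasSum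
    refine h4.congr_fun fun C => ?_
    have hpos := C.2.length_pos
    have hpow : ‖u ^ C.1.length‖ < 1 := by
      rw [norm_pow]
      exact pow_lt_one₀ (norm_nonneg _) hu1 hpos.ne'
    rw [(h3.summable.sigma_factor C).tsum_prod,
      ← (Complex.hasSum_taylorSeries_neg_log' hpow).tsum_eq]
    refine tsum_congr fun k => ?_
    have hne : (C.1.length : ℂ) ≠ 0 := by exact_mod_cast hpos.ne'
    have hk : (k : ℂ) + 1 ≠ 0 := by exact_mod_cast Nat.succ_ne_zero k
    simp only [Function.comp_apply, chain_primePower, if_true, length_primePower, tsum_fintype]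
    simp only [Finset.sum_const, Finset.card_univ, Fintype.card_fin, nsmul_eq_mul]
    push_cast
    rw [← pow_mul, mul_comm C.1.length]
    field_simp
  · intro l hl
    by_cases hne : l = []
    · simp [hne]
    · rw [if_neg]
      intro hc
      exact hl (exists_primePower_eq hne hc)

/-- The Euler product of the zeta function of a finite directed graph. -/
theorem eventually_hasProd_prime (r : α → α → Prop) :
    ∀ᶠ u : ℂ in nhds 0, HasProd
      (fun C : {C : Cycle α // C.IsPrime r} => (1 - u ^ C.1.length)⁻¹)
      (1 - u • Matrix.ofRel r).det⁻¹ := by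
  have h1 : ∀ᶠ u : ℂ in nhds 0, ‖u‖ < 1 :=
    (continuous_norm.tendsto (0 : ℂ)).eventually (gt_mem_nhds (by simp))
  have h2 : ∀ᶠ u : ℂ in nhds 0, Fintype.card α * ‖u‖ < 1 :=
    ((continuous_const.mul continuous_norm).tendsto (0 : ℂ)).eventually (gt_mem_nhds (by simp))
  filter_upwards [h1, h2, (Matrix.ofRel r).eventually_hasSum_trace_pow] with u hu1 hu2 ⟨s, hs, he⟩
  rw [← he]
  refine (hasSum_neg_log_prime r hu1 hu2 hs).cexp.congr_fun fun C => ?_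
  have hpow : ‖u ^ C.1.length‖ < 1 := by
    rw [norm_pow]
    exact pow_lt_one₀ (norm_nonneg _) hu1 C.2.length_pos.ne'
  have hne : 1 - u ^ C.1.length ≠ 0 := by
    intro h
    rw [← sub_eq_zero.1 h] at hpow
    simp at hpow
  simp [Complex.exp_neg, Complex.exp_log hne]

end Cycle

/-! ### Oriented edges and the Ihara–Bass formula. -/

theorem Set.ncard_setOf_eq_sum {E R : Type*} [Fintype E] [NonAssocSemiring R] (p : E → Prop)
    [DecidablePred p] : (({e : E | p e}.ncard : ℕ) : R) = ∑ e, if p e then 1 else 0 := by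
  rw [Set.ncard_eq_toFinset_card']
  simp

namespace Cycle

theorem chain_and_iff {α : Type*} {r s : α → α → Prop} {C : Cycle α} :
    C.Chain (fun a b => r a b ∧ s a b) ↔ C.Chain r ∧ C.Chain s := by
  induction C using Quotient.inductionOn with
  | h l =>
    rcases eq_or_ne l [] with rfl | hl
    · exact ⟨fun _ => ⟨Chain.nil r, Chain.nil s⟩, fun _ => Chain.nil _⟩
    · simp only [Cycle.mk''_eq_coe, chain_coe_iff_periodicSeq _ hl]
      exact ⟨fun h => ⟨fun i a ha b hb => (h i a ha b hb).1, fun i a ha b hb => (h i a ha b hb).2⟩,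
        fun h i a ha b hb => ⟨h.1 i a ha b hb, h.2 i a ha b hb⟩⟩

end Cycle

namespace Multigraph
variable {V E : Type*} (G : Multigraph V E)

/-- The oriented edge `b` may follow the oriented edge `a` in a backtrackless path. -/
def Follows (a b : E × Bool) : Prop := G.terminus a = G.origin b ∧ b ≠ reverse a

theorem isPrimeCycle_iff {C : Cycle (E × Bool)} : G.IsPrimeCycle C ↔ C.IsPrime G.Follows := by
  constructor
  · rintro ⟨h1, h2, h3, h4⟩
    exact ⟨h1, Cycle.chain_and_iff.2 ⟨h2, h3⟩, h4⟩
  · rintro ⟨h1, h2, h3⟩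
    exact ⟨h1, (Cycle.chain_and_iff.1 h2).1, (Cycle.chain_and_iff.1 h2).2, h3⟩

theorem reverse_reverse (a : E × Bool) : reverse (reverse a) = a := by simp [reverse]

theorem terminus_reverse (a : E × Bool) : G.terminus (reverse a) = G.origin a := by
  rw [terminus, reverse_reverse]

theorem ends_eq_origin_terminus (e : E) :
    G.ends e = s(G.origin (e, true), G.origin (e, false)) := by
  simp only [origin, if_true, Bool.false_eq_true, if_false]
  exact (Quot.out_eq (G.ends e)).symm

section matrices

variable [DecidableEq V]

/-- The incidence matrix of vertices and origins of oriented edges. -/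
noncomputable def originMatrix : Matrix V (E × Bool) ℂ :=
  Matrix.of fun v a => if G.origin a = v then 1 else 0

/-- The incidence matrix of vertices and termini of oriented edges. -/
noncomputable def terminusMatrix : Matrix V (E × Bool) ℂ :=
  Matrix.of fun v a => if G.terminus a = v then 1 else 0

variable (E) in
/-- The permutation matrix of the reversal of oriented edges. -/
def reverseMatrix [DecidableEq E] : Matrix (E × Bool) (E × Bool) ℂ :=
  Matrix.of fun a b => if b = reverse a then 1 else 0

open Matrix

theorem reverseMatrix_mul_apply [Fintype E] [DecidableEq E] {β : Type*}
    (M : Matrix (E × Bool) β ℂ) (a : E × Bool) (c : β) :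
    (reverseMatrix E * M) a c = M (reverse a) c := by
  simp [reverseMatrix, mul_apply]

theorem reverseMatrix_mul_self [Fintype E] [DecidableEq E] :
    reverseMatrix E * reverseMatrix E = 1 := by
  ext a b
  rw [reverseMatrix_mul_apply]
  simp [reverseMatrix, reverse_reverse, one_apply, eq_comm]

theorem reverseMatrix_mul_terminusMatrix [Fintype E] [DecidableEq E] :
    reverseMatrix E * G.terminusMatrixᵀ = G.originMatrixᵀ := by
  ext a v
  rw [reverseMatrix_mul_apply]
  simp [terminusMatrix, originMatrix, terminus_reverse]

-- Each edge contributes one 2 × 2 block with diagonal `1` and off-diagonal `u`.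
open Kronecker in
theorem det_one_add_smul_reverseMatrix [Fintype E] [DecidableEq E] (u : ℂ) :
    (1 + u • reverseMatrix E).det = (1 - u ^ 2) ^ Fintype.card E := by
  have h : 1 + u • reverseMatrix E =
      (1 : Matrix E E ℂ) ⊗ₖ (Matrix.of fun b c : Bool => if b = c then (1 : ℂ) else u) := by
    ext ⟨e, b⟩ ⟨f, c⟩
    by_cases hef : e = f
    · subst hef
      cases b <;> cases c <;> simp [reverseMatrix, reverse, kroneckerMap_apply, one_apply]
    · simp [reverseMatrix, reverse, kroneckerMap_apply, one_apply, hef, Ne.symm hef]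
  rw [h, det_kronecker, det_one, one_pow, one_mul,
    ← det_reindex_self finTwoEquiv.symm, det_fin_two]
  simp [pow_two]

/-- The reverse of `a` always starts where `a` ends, so subtracting the reversal removes exactly the
backtracks. -/
theorem ofRel_follows_eq [Fintype V] [DecidableEq E] :
    Matrix.ofRel G.Follows = G.terminusMatrixᵀ * G.originMatrix - reverseMatrix E := by
  ext a b
  have h : b = reverse a → G.terminus a = G.origin b := by rintro rfl; rfl
  simp only [ofRel, Follows, of_apply, Matrix.sub_apply, mul_apply, transpose_apply, terminusMatrix,
    originMatrix, reverseMatrix]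
  by_cases h1 : b = reverse a <;> by_cases h2 : G.terminus a = G.origin b
  all_goals simp_all [eq_comm]

/-- A loop is counted through both of its orientations, in agreement with the convention for
adjacency. -/
theorem originMatrix_mul_terminusMatrix [Fintype E] :
    G.originMatrix * G.terminusMatrixᵀ = G.adjMatrix.map Complex.ofReal := by
  classical
  ext v w
  simp only [originMatrix, terminusMatrix, adjMatrix, mul_apply, of_apply, transpose_apply,
    map_apply, Fintype.sum_prod_type, Fintype.sum_bool, Set.ncard_setOf_eq_sum]
  push_cast
  rw [Finset.mul_sum]
  refine Finset.sum_congr rfl fun e _ => ?_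
  rw [G.ends_eq_origin_terminus e]
  simp only [terminus, reverse, Bool.not_true, Bool.not_false, Sym2.eq_iff]
  generalize G.origin (e, true) = p
  generalize G.origin (e, false) = q
  by_cases h1 : p = v <;> by_cases h2 : q = w <;> by_cases h3 : p = w <;> by_cases h4 : q = v <;>
    by_cases h5 : v = w <;> simp_all
  all_goals norm_num

theorem originMatrix_mul_transpose [Fintype E] :
    G.originMatrix * G.originMatrixᵀ = diagonal fun v => (G.degree v : ℂ) := by
  classical
  ext v w
  simp only [originMatrix, degree, mul_apply, of_apply, transpose_apply, diagonal_apply,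
    Fintype.sum_prod_type, Fintype.sum_bool]
  split_ifs with hvw
  · subst hvw
    push_cast
    rw [Set.ncard_setOf_eq_sum, Set.ncard_setOf_eq_sum, ← Finset.sum_add_distrib]
    refine Finset.sum_congr rfl fun e _ => ?_
    rw [G.ends_eq_origin_terminus e]
    simp only [Sym2.eq_iff, Sym2.mem_iff]
    by_cases h1 : G.origin (e, true) = v <;> by_cases h2 : G.origin (e, false) = v <;>
      simp [h1, h2, eq_comm (a := v)]
  · refine Finset.sum_eq_zero fun e _ => ?_
    by_cases h1 : G.origin (e, true) = v <;> by_cases h2 : G.origin (e, false) = v <;>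
      simp [h1, h2, hvw]

/-- **Bass's determinant formula**. -/
theorem det_one_sub_ofRel_follows [Fintype V] [Fintype E] [DecidableEq E] {u : ℂ}
    (hu : 1 - u ^ 2 ≠ 0) :
    (1 - u • Matrix.ofRel G.Follows).det =
      (1 - u ^ 2) ^ ((Fintype.card E : ℤ) - Fintype.card V) *
      (diagonal (fun v => 1 + ((G.degree v : ℂ) - 1) * u ^ 2)
        - u • G.adjMatrix.map Complex.ofReal).det := by
  set R := reverseMatrix E with hR
  -- Since `R ^ 2 = 1`, this is the inverse of `1 + u R`. Factoring `1 + u R` out leaves `1 - X Y`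
  -- with `X Y` through the vertex space, where `det (1 - X Y) = det (1 - Y X)` applies.
  set N : Matrix (E × Bool) (E × Bool) ℂ := (1 - u ^ 2)⁻¹ • (1 - u • R) with hN
  have hRN : (1 + u • R) * N = 1 := by
    have : (1 + u • R) * (1 - u • R) = (1 - u ^ 2) • 1 := by
      rw [add_mul, mul_sub, mul_sub, smul_mul_smul_comm, hR, reverseMatrix_mul_self, sub_smul]
      simp [pow_two]
    rw [hN, mul_smul_comm, this, smul_smul, inv_mul_cancel₀ hu, one_smul]
  have h1 : 1 - u • Matrix.ofRel G.Follows =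
      (1 + u • R) * (1 - (u • (N * G.terminusMatrixᵀ)) * G.originMatrix) := by
    rw [mul_sub, mul_one, ← Matrix.mul_assoc, Matrix.mul_smul, ← Matrix.mul_assoc, hRN,
      Matrix.one_mul, ofRel_follows_eq, smul_sub, Matrix.smul_mul]
    abel
  have h2 : 1 - G.originMatrix * (u • (N * G.terminusMatrixᵀ)) =
      (1 - u ^ 2)⁻¹ • (diagonal (fun v => 1 + ((G.degree v : ℂ) - 1) * u ^ 2)
        - u • G.adjMatrix.map Complex.ofReal) := by
    have h3 : diagonal (fun v => 1 + ((G.degree v : ℂ) - 1) * u ^ 2) =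
        (1 - u ^ 2) • 1 + u ^ 2 • diagonal (fun v => (G.degree v : ℂ)) := by
      ext v w
      simp only [diagonal_apply, Matrix.add_apply, Matrix.smul_apply, one_apply, smul_eq_mul]
      split_ifs <;> ring
    rw [h3, hN, Matrix.smul_mul, Matrix.sub_mul, Matrix.one_mul, Matrix.smul_mul,
      reverseMatrix_mul_terminusMatrix, Matrix.mul_smul, Matrix.mul_smul, Matrix.mul_sub,
      Matrix.mul_smul, originMatrix_mul_terminusMatrix, originMatrix_mul_transpose]
    have h4 : (1 : Matrix V V ℂ) = (1 - u ^ 2)⁻¹ • ((1 - u ^ 2) • 1) := by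
      rw [smul_smul, inv_mul_cancel₀ hu, one_smul]
    conv_lhs => rw [h4]
    module
  rw [h1, det_mul, det_one_add_smul_reverseMatrix, det_one_sub_mul_comm, h2, det_smul,
    ← mul_assoc, zpow_sub₀ hu, zpow_natCast, zpow_natCast, inv_pow, div_eq_mul_inv]

/-- The Ihara–Bass theorem for finite multigraphs. -/
theorem eventually_hasProd_eulerFactor [Fintype V] [Fintype E] :
    ∀ᶠ u : ℂ in nhds 0, HasProd (G.eulerFactor u)
      ((1 - u ^ 2) ^ ((Fintype.card E : ℤ) - Fintype.card V) *
      (diagonal (fun v => 1 + ((G.degree v : ℂ) - 1) * u ^ 2)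
        - u • G.adjMatrix.map Complex.ofReal).det)⁻¹ := by
  classical
  have hu : ∀ᶠ u : ℂ in nhds 0, 1 - u ^ 2 ≠ 0 :=
    ((by fun_prop : Continuous fun u : ℂ => 1 - u ^ 2).tendsto 0).eventually_ne (by simp)
  filter_upwards [hu, Cycle.eventually_hasProd_prime G.Follows] with u hu h
  rw [← G.det_one_sub_ofRel_follows hu]
  exact ((Equiv.subtypeEquivRight fun C => G.isPrimeCycle_iff (C := C)).hasProd_iff).2 h

/-- The product is an inverse, which would be `0` by convention at a zero of the determinant. Near
`0` there is none, by continuity and the value `1` at `u = 0`. -/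
theorem eventually_iharaZeta_ne_zero [Fintype V] [Fintype E] :
    ∀ᶠ u : ℂ in nhds 0, G.iharaZeta u ≠ 0 := by
  have hu : ∀ᶠ u : ℂ in nhds 0, 1 - u ^ 2 ≠ 0 :=
    ((by fun_prop : Continuous fun u : ℂ => 1 - u ^ 2).tendsto 0).eventually_ne (by simp)
  have hcont : Continuous fun u : ℂ => (diagonal (fun v => 1 + ((G.degree v : ℂ) - 1) * u ^ 2)
        - u • G.adjMatrix.map Complex.ofReal).det := by
    refine Continuous.matrix_det (Continuous.sub (Continuous.matrix_diagonal ?_) ?_) <;> fun_prop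
  have hd := (hcont.tendsto 0).eventually_ne (b₂ := 0) (by simp)
  filter_upwards [hu, hd, G.eventually_hasProd_eulerFactor] with u hu hd h
  rw [iharaZeta, h.tprod_eq]
  exact inv_ne_zero (mul_ne_zero (zpow_ne_zero _ hu) hd)

end matrices

end Multigraph

/-! ### Determinants of bipartite and joined block matrices. -/

namespace Matrix
open Polynomial

/-- Multiplication by a block triangular matrix clears the upper right block. Keeping powers of `x`
on both sides avoids inverting `x`, so `x = 0` is allowed. -/
theorem det_fromBlocks_smul_one {R m n : Type*} [CommRing R] [Fintype m] [Fintype n]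
    [DecidableEq m] [DecidableEq n] (B : Matrix m n R) (C : Matrix n m R) (x y : R) :
    (fromBlocks (x • 1) (-B) (-C) (y • 1)).det * x ^ Fintype.card n =
      x ^ Fintype.card m * ((x * y) • 1 - C * B).det := by
  have h1 : (fromBlocks (1 : Matrix m m R) B 0 (x • (1 : Matrix n n R))).det =
      x ^ Fintype.card n := by
    rw [det_fromBlocks_zero₂₁]; simp
  have h2 : fromBlocks (x • 1) (-B) (-C) (y • 1) *
      fromBlocks (1 : Matrix m m R) B 0 (x • (1 : Matrix n n R)) =
      fromBlocks (x • 1) 0 (-C) ((x * y) • 1 - C * B) := by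
    rw [fromBlocks_multiply]
    congr 1
    · simp
    · simp
    · simp
    · rw [smul_mul_smul_comm, Matrix.neg_mul, mul_one, mul_comm x y]; abel
  rw [← h1, ← det_mul, h2, det_fromBlocks_zero₁₂]
  simp

section bipartite
variable {V : Type*} [Fintype V] [DecidableEq V]

/-- The determinant of `diag(x, y) - u A` for a bipartite matrix `A`. -/
theorem det_diagonal_sub_smul_bipartite {R : Type*} [CommRing R] (A : Matrix V V R)
    (p : V → Prop) [DecidablePred p] (hA : ∀ v w, (p v ↔ p w) → A v w = 0) (x y u : R) :
    (diagonal (fun v => if p v then x else y) - u • A).det * x ^ Fintype.card {v // ¬p v} =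
      x ^ Fintype.card {v // p v} * ((x * y) • 1 -
        u ^ 2 • (A.toBlock (fun v => ¬p v) p * A.toBlock p (fun v => ¬p v))).det := by
  have h := det_fromBlocks_smul_one (u • A.toBlock p (fun v => ¬p v))
    (u • A.toBlock (fun v => ¬p v) p) x y
  rw [Matrix.smul_mul, Matrix.mul_smul, smul_smul, ← pow_two] at h
  rw [← h, det_toBlock _ p]
  congr 3
  · ext v w
    by_cases hvw : v = w
    · simp [toBlock, hvw, hA w.1 w.1 Iff.rfl, w.2]
    · simp [toBlock, hvw, hA v.1 w.1 (by simp [v.2, w.2]), Subtype.val_inj]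
  · ext v w
    have hne : v.1 ≠ w.1 := fun h => w.2 (h ▸ v.2)
    simp [toBlock, hne]
  · ext v w
    have hne : v.1 ≠ w.1 := fun h => v.2 (h ▸ w.2)
    simp [toBlock, hne]
  · ext v w
    by_cases hvw : v = w
    · simp [toBlock, hvw, hA w.1 w.1 Iff.rfl, w.2]
    · simp [toBlock, hvw, hA v.1 w.1 (by simp [v.2, w.2]), Subtype.val_inj]

/-- The singular values of the off-diagonal block of a symmetric bipartite matrix determine the
positive eigenvalues and the determinants of `diag(x, y) - u A`. -/
theorem exists_singular_values (A : Matrix V V ℝ) (hs : A.IsSymm)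
    (p : V → Prop) [DecidablePred p] (hA : ∀ v w, (p v ↔ p w) → A v w = 0) :
    ∃ m : Multiset ℝ, (∀ t ∈ m, 0 ≤ t) ∧ m.card = Fintype.card {v // ¬p v} ∧
      A.charpoly.roots.filter (fun x => 0 < x) = m.filter (fun x => 0 < x) ∧
      ∀ x y u : ℂ,
        (diagonal (fun v => if p v then x else y) - u • A.map Complex.ofReal).det *
          x ^ Fintype.card {v // ¬p v} =
        x ^ Fintype.card {v // p v} * (m.map fun t : ℝ => x * y - (t : ℂ) ^ 2 * u ^ 2).prod := by
  set B := A.toBlock p (fun v => ¬p v) with hB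
  have hBt : A.toBlock (fun v => ¬p v) p = Bᴴ := by
    ext v w
    simp [hB, toBlock, hs.apply]
  have hpsd : (Bᴴ * B).PosSemidef := posSemidef_conjTranspose_mul_self B
  set ev := hpsd.isHermitian.eigenvalues with hev
  have hcp : (Bᴴ * B).charpoly = ∏ i, (X - C (ev i)) := hpsd.isHermitian.charpoly_eq
  have hev0 : ∀ i, 0 ≤ ev i := hpsd.eigenvalues_nonneg
  -- The singular values of `B`, zeros included, one for each vertex outside `p`.
  refine ⟨Finset.univ.val.map fun i => √(ev i), ?_, ?_, ?_, ?_⟩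
  · intro t ht
    obtain ⟨i, -, rfl⟩ := Multiset.mem_map.1 ht
    exact Real.sqrt_nonneg _
  · simp
  -- At `x = y = t`, `u = 1` the determinant is the characteristic polynomial. Up to powers of `X`,
  -- its roots are thus the singular values and their negatives; the filter discards the negatives
  -- and zeros.
  · have hpoly : A.charpoly * X ^ Fintype.card {v // ¬p v} =
        X ^ Fintype.card {v // p v} *
          ∏ i, ((X - C (√(ev i))) * (X - C (-√(ev i)))) := by
      refine Polynomial.funext fun t => ?_
      have h1 := det_diagonal_sub_smul_bipartite A p hA t t 1
      have h2 : (diagonal fun v => if p v then t else t) - (1 : ℝ) • A = scalar V t - A := by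
        simp
      rw [h2, ← eval_charpoly, hBt, one_pow, one_smul, smul_one_eq_diagonal, ← scalar_apply,
        ← eval_charpoly, hcp] at h1
      simp only [eval_mul, eval_pow, eval_X, eval_prod] at h1 ⊢
      rw [h1]
      congr 1
      refine Finset.prod_congr rfl fun i _ => ?_
      simp only [eval_sub, eval_X, eval_C]
      have := Real.mul_self_sqrt (hev0 i)
      linear_combination this
    have hne : ∀ i, (X - C (√(ev i))) * (X - C (-√(ev i))) ≠ 0 := fun i =>
      mul_ne_zero (X_sub_C_ne_zero _) (X_sub_C_ne_zero _)
    have hroots := congrArg (fun q : ℝ[X] => q.roots.filter (fun x => 0 < x)) hpoly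
    rw [roots_mul (mul_ne_zero A.charpoly_monic.ne_zero (pow_ne_zero _ X_ne_zero)),
      roots_mul (mul_ne_zero (pow_ne_zero _ X_ne_zero) (Finset.prod_ne_zero_iff.2 fun i _ => hne i)),
      roots_X_pow, roots_X_pow, roots_prod _ _ (Finset.prod_ne_zero_iff.2 fun i _ => hne i),
      Multiset.filter_add, Multiset.filter_add, Multiset.filter_nsmul, Multiset.filter_nsmul,
      Multiset.filter_singleton, if_neg (lt_irrefl 0)] at hroots
    rw [Multiset.empty_eq_zero, smul_zero, smul_zero, add_zero, zero_add] at hroots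
    rw [hroots, ← Multiset.bind_singleton, Multiset.filter_bind, Multiset.filter_bind]
    refine Multiset.bind_congr fun i _ => ?_
    rw [roots_mul (hne i), roots_X_sub_C, roots_X_sub_C, Multiset.filter_add,
      Multiset.filter_singleton (a := -√(ev i)), if_neg (by simp)]
    exact add_zero _
  · intro x y u
    have h1 := det_diagonal_sub_smul_bipartite (A.map Complex.ofReal) p
      (fun v w h => by simp [hA v w h]) x y u
    rw [h1]
    congr 1
    have h2 : (A.map Complex.ofReal).toBlock (fun v => ¬p v) p *
        (A.map Complex.ofReal).toBlock p (fun v => ¬p v) = (Bᴴ * B).map Complex.ofReal := by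
      rw [← hBt]
      ext v w
      simp [toBlock, mul_apply, hB]
    have h3 : ((Bᴴ * B).map Complex.ofReal).charpoly.roots =
        Finset.univ.val.map fun i => (ev i : ℂ) := by
      have : ((Bᴴ * B).map Complex.ofReal).charpoly = ∏ i, (X - C (ev i : ℂ)) := by
        rw [show (Bᴴ * B).map Complex.ofReal = (Bᴴ * B).map Complex.ofRealHom from rfl,
          charpoly_map, hcp, Polynomial.map_prod]
        simp
      rw [this, ← roots_multiset_prod_X_sub_C (Finset.univ.val.map fun i => (ev i : ℂ)),
        Multiset.map_map]
      rfl
    have h4 := det_aeval_eq_prod_roots ((Bᴴ * B).map Complex.ofReal) (C (x * y) - C (u ^ 2) * X)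
    rw [h3, Multiset.map_map] at h4
    rw [h2, Multiset.map_map]
    have h5 : aeval ((Bᴴ * B).map Complex.ofReal) (C (x * y) - C (u ^ 2) * X) =
        (x * y) • 1 - u ^ 2 • (Bᴴ * B).map Complex.ofReal := by
      rw [map_sub, map_mul (aeval _), aeval_C, aeval_C, aeval_X, ← Algebra.smul_def,
        Algebra.algebraMap_eq_smul_one]
    rw [← h5, h4]
    congr 1
    refine Multiset.map_congr rfl fun i _ => ?_
    have : ((√(ev i) : ℝ) : ℂ) ^ 2 = ev i := by exact_mod_cast Real.sq_sqrt (hev0 i)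
    simp only [Function.comp_apply, eval_sub, eval_mul, eval_C, eval_X, this]
    ring

end bipartite

/-- A positive eigenvector of a non-negative matrix belongs to its largest eigenvalue. -/
theorem abs_le_of_nonneg_of_mulVec_eq {V : Type*} [Fintype V] {A : Matrix V V ℝ}
    (hA : ∀ v w, 0 ≤ A v w) {f g : V → ℝ} {ρ t : ℝ} (hf : ∀ v, 0 < f v) (hAf : A *ᵥ f = ρ • f)
    (hg : g ≠ 0) (hAg : A *ᵥ g = t • g) : |t| ≤ ρ := by
  obtain ⟨w, hw⟩ := Function.ne_iff.1 hg
  have : Nonempty V := ⟨w⟩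
  -- At a maximiser `v` of `|g| / f`, the bound `|g| ≤ c f` is an equality, so comparing `A g` with
  -- `c A f` there bounds `|t|`.
  obtain ⟨v, hv⟩ := Finite.exists_max fun v => |g v| / f v
  set c := |g v| / f v with hc
  have hle : ∀ w, |g w| ≤ c * f w := fun w => (div_le_iff₀ (hf w)).1 (hv w)
  have hcpos : 0 < c := (div_pos (abs_pos.2 hw) (hf w)).trans_le (hv w)
  have hgv : |g v| = c * f v := by rw [hc, div_mul_cancel₀ _ (hf v).ne']
  have h1 : |t| * |g v| ≤ ρ * |g v| := by
    calc |t| * |g v| = |(A *ᵥ g) v| := by rw [hAg, Pi.smul_apply, smul_eq_mul, abs_mul]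
      _ ≤ ∑ w, |A v w * g w| := Finset.abs_sum_le_sum_abs _ _
      _ ≤ ∑ w, c * (A v w * f w) := by
        refine Finset.sum_le_sum fun w _ => ?_
        rw [abs_mul, abs_of_nonneg (hA v w)]
        nlinarith [mul_le_mul_of_nonneg_left (hle w) (hA v w)]
      _ = c * (A *ᵥ f) v := by rw [← Finset.mul_sum]; rfl
      _ = ρ * |g v| := by rw [hAf, Pi.smul_apply, smul_eq_mul, hgv]; ring
  have hpos : 0 < |g v| := by rw [hgv]; exact mul_pos hcpos (hf v)
  exact le_of_mul_le_mul_right h1 hpos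

theorem isRoot_charpoly_iff_exists {K V : Type*} [Field K] [Fintype V] [DecidableEq V]
    {A : Matrix V V K} {t : K} : A.charpoly.IsRoot t ↔ ∃ g ≠ 0, A *ᵥ g = t • g := by
  rw [IsRoot, eval_charpoly, ← exists_mulVec_eq_zero_iff]
  refine exists_congr fun g => and_congr_right fun _ => ?_
  rw [sub_mulVec, sub_eq_zero, eq_comm, scalar_apply, ← smul_one_eq_diagonal, smul_mulVec,
    one_mulVec]

/-- The determinant of two blocks joined by constant matrices. -/
theorem det_fromBlocks_const {m n R : Type*} [CommRing R] [Fintype m] [Fintype n] [DecidableEq m]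
    [DecidableEq n] {M : Matrix m m R} {N : Matrix n n R} {y : m → R} {z : n → R}
    (hy : M *ᵥ y = 1) (hz : N *ᵥ z = 1) (u : R) :
    (fromBlocks M (of fun _ _ => -u) (of fun _ _ => -u) N).det =
      M.det * N.det * (1 - (∑ i, y i) * (∑ j, z j) * u ^ 2) := by
  -- As `M y = 1` and `N z = 1`, the constant blocks are multiples of `M` and `N`, so the block
  -- diagonal factors out without inverses and leaves rank-one blocks.
  have h1 : fromBlocks M (of fun _ _ => -u) (of fun _ _ => -u) N = fromBlocks M 0 0 N *
      fromBlocks 1 (vecMulVec (-u • y) 1) (vecMulVec (-u • z) 1) 1 := by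
    rw [fromBlocks_multiply]
    congr 1
    · simp
    · rw [Matrix.zero_mul, add_zero, mul_vecMulVec, mulVec_smul, hy]
      ext i j; simp [vecMulVec]
    · rw [Matrix.zero_mul, zero_add, mul_vecMulVec, mulVec_smul, hz]
      ext i j; simp [vecMulVec]
    · simp
  have h2 : (vecMulVec (-u • z) 1 : Matrix n m R) * (vecMulVec (-u • y) 1 : Matrix m n R) =
      -(replicateCol Unit (-((u ^ 2 * ∑ i, y i) • z)) * replicateRow Unit (1 : n → R)) := by
    ext i j
    simp only [vecMulVec, mul_apply, Matrix.neg_apply, of_apply, replicateCol_apply,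
      replicateRow_apply, Pi.smul_apply, Pi.neg_apply, Pi.one_apply, smul_eq_mul, mul_one,
      Finset.univ_unique, Finset.sum_singleton, ← Finset.mul_sum]
    ring
  rw [h1, det_mul, det_fromBlocks_zero₁₂, det_fromBlocks_one₁₁, h2, sub_neg_eq_add,
    det_one_add_replicateCol_mul_replicateRow]
  simp only [dotProduct, Pi.one_apply, Pi.neg_apply, Pi.smul_apply, smul_eq_mul, one_mul,
    Finset.sum_neg_distrib, ← Finset.mul_sum]
  ring

end Matrix

/-! ### Degrees and Bass matrices of joins. -/

namespace Multigraph
open Matrix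

section general
variable {V E : Type*} [DecidableEq V] (G : Multigraph V E)

theorem adjMatrix_nonneg (v w : V) : 0 ≤ G.adjMatrix v w := by
  simp only [adjMatrix, of_apply]
  positivity

theorem adjMatrix_isSymm : G.adjMatrix.IsSymm := by
  ext v w
  simp only [adjMatrix, transpose_apply, of_apply, Sym2.eq_swap (a := w) (b := v),
    eq_comm (a := w) (b := v)]

theorem originMatrix_transpose_mulVec_one [Fintype V] : G.originMatrixᵀ *ᵥ 1 = 1 := by
  ext a
  simp [originMatrix, mulVec, dotProduct]

theorem terminusMatrix_transpose_mulVec_one [Fintype V] : G.terminusMatrixᵀ *ᵥ 1 = 1 := by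
  ext a
  simp [terminusMatrix, mulVec, dotProduct]

/-- Every oriented edge has one origin and one terminus, so both incidence products act alike on the
all-ones vector. -/
theorem sum_adjMatrix [Fintype V] [Fintype E] (v : V) :
    ∑ w, G.adjMatrix v w = G.degree v := by
  have h : (G.adjMatrix.map Complex.ofReal) *ᵥ 1 =
      (diagonal fun v => (G.degree v : ℂ)) *ᵥ 1 := by
    rw [← originMatrix_mul_terminusMatrix, ← originMatrix_mul_transpose, ← mulVec_mulVec,
      ← mulVec_mulVec, originMatrix_transpose_mulVec_one, terminusMatrix_transpose_mulVec_one]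
  have h1 := congrFun h v
  simp only [mulVec, dotProduct, map_apply, Pi.one_apply, mul_one, diagonal_apply,
    Finset.sum_ite_eq, Finset.mem_univ, if_true] at h1
  exact_mod_cast h1

theorem sum_degree_eq_sum [Fintype E] (S : Finset V) :
    (∑ v ∈ S, (G.degree v : ℂ)) =
      ∑ e, ((if G.origin (e, true) ∈ S then 1 else 0) +
        (if G.origin (e, false) ∈ S then 1 else 0)) := by
  have h : ∀ v, (G.degree v : ℂ) = ∑ a, if G.origin a = v then 1 else 0 := by
    intro v
    have := congrFun (congrFun G.originMatrix_mul_transpose v) v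
    rw [diagonal_apply_eq] at this
    rw [← this]
    simp only [originMatrix, mul_apply, of_apply, transpose_apply]
    refine Finset.sum_congr rfl fun a _ => ?_
    split_ifs <;> simp
  simp only [h]
  rw [Finset.sum_comm, Fintype.sum_prod_type]
  simp only [Finset.sum_ite_eq, Fintype.sum_bool]

end general

section join
variable {V₁ E₁ V₂ E₂ : Type*} [DecidableEq V₁] [DecidableEq V₂]
  (G₁ : Multigraph V₁ E₁) (G₂ : Multigraph V₂ E₂)

theorem adjMatrix_join [Fintype V₁] [Fintype V₂] [Fintype E₁] [Fintype E₂] :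
    (G₁.join G₂).adjMatrix =
      fromBlocks G₁.adjMatrix (of fun _ _ => 1) (of fun _ _ => 1) G₂.adjMatrix := by
  classical
  have hl : ∀ (e : Sym2 V₁) (v w : V₁),
      e.map Sum.inl = s((Sum.inl v : V₁ ⊕ V₂), Sum.inl w) ↔ e = s(v, w) := fun e v w => by
    rw [← Sym2.map_mk]; exact (Sym2.map.injective Sum.inl_injective).eq_iff
  have hr : ∀ (e : Sym2 V₂) (v w : V₂),
      e.map Sum.inr = s((Sum.inr v : V₁ ⊕ V₂), Sum.inr w) ↔ e = s(v, w) := fun e v w => by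
    rw [← Sym2.map_mk]; exact (Sym2.map.injective Sum.inr_injective).eq_iff
  have hl' : ∀ (e : Sym2 V₁) (x : V₁ ⊕ V₂) (w : V₂), e.map Sum.inl ≠ s(x, Sum.inr w) := by
    intro e x w h
    have : Sum.inr w ∈ e.map (Sum.inl : V₁ → V₁ ⊕ V₂) := h ▸ Sym2.mem_mk_right _ _
    simp at this
  have hr' : ∀ (e : Sym2 V₂) (x : V₁ ⊕ V₂) (w : V₁), e.map Sum.inr ≠ s(x, Sum.inl w) := by
    intro e x w h
    have : Sum.inl w ∈ e.map (Sum.inr : V₂ → V₁ ⊕ V₂) := h ▸ Sym2.mem_mk_right _ _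
    simp at this
  have hl'' : ∀ (e : Sym2 V₁) (x : V₁ ⊕ V₂) (w : V₂), e.map Sum.inl ≠ s(Sum.inr w, x) := by
    intro e x w; rw [Sym2.eq_swap]; exact hl' e x w
  have hr'' : ∀ (e : Sym2 V₂) (x : V₁ ⊕ V₂) (w : V₁), e.map Sum.inr ≠ s(Sum.inl w, x) := by
    intro e x w; rw [Sym2.eq_swap]; exact hr' e x w
  ext (v | v) (w | w)
  all_goals simp only [adjMatrix, Set.ncard_setOf_eq_sum, Fintype.sum_sum_type, join, of_apply]
  · simp [hl, hr']
  · simp only [reduceCtorEq, if_false, hl', hr'', Finset.sum_const_zero, zero_add, one_mul,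
      fromBlocks_apply₁₂, of_apply]
    rw [Finset.sum_eq_single (v, w)] <;> simp +contextual [Prod.ext_iff]
  · simp only [reduceCtorEq, if_false, hl'', hr', Finset.sum_const_zero, zero_add, one_mul,
      fromBlocks_apply₂₁, of_apply]
    rw [Finset.sum_eq_single (w, v)] <;> simp +contextual [Prod.ext_iff]
  · simp [hr, hl']

variable [Fintype V₁] [Fintype V₂] [Fintype E₁] [Fintype E₂]

theorem degree_join_inl (v : V₁) :
    (G₁.join G₂).degree (Sum.inl v) = G₁.degree v + Fintype.card V₂ := by
  have h := (G₁.join G₂).sum_adjMatrix (Sum.inl v)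
  rw [adjMatrix_join, Fintype.sum_sum_type] at h
  simp only [fromBlocks_apply₁₁, fromBlocks_apply₁₂, of_apply, G₁.sum_adjMatrix] at h
  simp only [Finset.sum_const, Finset.card_univ, nsmul_eq_mul, mul_one] at h
  exact_mod_cast h.symm

theorem degree_join_inr (v : V₂) :
    (G₁.join G₂).degree (Sum.inr v) = G₂.degree v + Fintype.card V₁ := by
  have h := (G₁.join G₂).sum_adjMatrix (Sum.inr v)
  rw [adjMatrix_join, Fintype.sum_sum_type] at h
  simp only [fromBlocks_apply₂₁, fromBlocks_apply₂₂, of_apply, G₂.sum_adjMatrix] at h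
  simp only [Finset.sum_const, Finset.card_univ, nsmul_eq_mul, mul_one] at h
  rw [add_comm]
  exact_mod_cast h.symm

/-- The matrix of Bass's formula for a graph whose vertices get `ν` additional neighbours. -/
noncomputable def bassMatrix {V E : Type*} [DecidableEq V] (G : Multigraph V E) (ν : ℕ) (u : ℂ) :
    Matrix V V ℂ :=
  diagonal (fun v => 1 + ((G.degree v : ℂ) + ν - 1) * u ^ 2) - u • G.adjMatrix.map Complex.ofReal

theorem bassMatrix_join (u : ℂ) :
    diagonal (fun v => 1 + (((G₁.join G₂).degree v : ℂ) - 1) * u ^ 2)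
        - u • (G₁.join G₂).adjMatrix.map Complex.ofReal =
      fromBlocks (G₁.bassMatrix (Fintype.card V₂) u) (of fun _ _ => -u) (of fun _ _ => -u)
        (G₂.bassMatrix (Fintype.card V₁) u) := by
  rw [adjMatrix_join]
  ext (v | v) (w | w)
  · simp [bassMatrix, diagonal_apply, degree_join_inl]
  · simp
  · simp
  · simp [bassMatrix, diagonal_apply, degree_join_inr]

end join

/-! ### Semi-regular bipartite graphs. -/

namespace IsSemiregularBipartite
variable {V E : Type*} [Fintype V] [DecidableEq V] [Fintype E] {G : Multigraph V E}
  {S T : Finset V} {p q : ℕ}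

omit [Fintype E] in
theorem notMem_left_iff (h : G.IsSemiregularBipartite S T p q) (v : V) : v ∉ S ↔ v ∈ T := by
  constructor
  · intro hv
    have : v ∈ S ∪ T := h.union_eq ▸ Finset.mem_univ v
    exact (Finset.mem_union.1 this).resolve_left hv
  · exact fun hv hS => Finset.disjoint_left.1 h.disjoint hS hv

omit [Fintype E] in
theorem card_vertices (h : G.IsSemiregularBipartite S T p q) :
    Fintype.card V = S.card + T.card := by
  rw [← Finset.card_union_of_disjoint h.disjoint, h.union_eq, Finset.card_univ]

omit [Fintype E] in
theorem adjMatrix_eq_zero (h : G.IsSemiregularBipartite S T p q) (v w : V)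
    (hvw : v ∈ S ↔ w ∈ S) : G.adjMatrix v w = 0 := by
  have : {e : E | G.ends e = s(v, w)} = ∅ := by
    refine Set.eq_empty_of_forall_notMem fun e he => ?_
    obtain ⟨a, ha, b, hb, hab⟩ := h.ends_mem e
    change G.ends e = _ at he
    rw [hab, Sym2.eq_iff] at he
    have hb' := (h.notMem_left_iff b).2 hb
    rcases he with ⟨rfl, rfl⟩ | ⟨rfl, rfl⟩ <;> tauto
  simp [adjMatrix, this]

/-- Exactly one end of each edge lies in `S`, so the degrees over `S` count every edge once. -/
theorem card_edges (h : G.IsSemiregularBipartite S T p q) : Fintype.card E = S.card * p := by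
  have h1 := G.sum_degree_eq_sum S
  rw [Finset.sum_congr rfl fun v hv => by rw [h.degree_left v hv]] at h1
  have h2 : ∀ e : E, ((if G.origin (e, true) ∈ S then (1 : ℂ) else 0) +
        (if G.origin (e, false) ∈ S then 1 else 0)) = 1 := by
    intro e
    obtain ⟨a, ha, b, hb, hab⟩ := h.ends_mem e
    have hb' := (h.notMem_left_iff b).2 hb
    rw [G.ends_eq_origin_terminus e, Sym2.eq_iff] at hab
    rcases hab with ⟨h1, h2⟩ | ⟨h1, h2⟩ <;> simp [h1, h2, ha, hb']
  rw [Finset.sum_congr rfl fun e _ => h2 e] at h1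
  simp only [Finset.sum_const, Finset.card_univ, nsmul_eq_mul, mul_one] at h1
  exact_mod_cast h1.symm

/-- The action of the adjacency matrix on functions that are constant on the classes. -/
theorem adjMatrix_mulVec (h : G.IsSemiregularBipartite S T p q) {K : Type*} [Field K]
    (f : ℝ →+* K) (a b : K) :
    (G.adjMatrix.map f *ᵥ fun v => if v ∈ S then a else b) =
      fun v => if v ∈ S then p * b else q * a := by
  ext v
  simp only [mulVec, dotProduct, map_apply]
  have hsum : ∑ w, f (G.adjMatrix v w) = G.degree v := by
    rw [← map_sum, G.sum_adjMatrix, map_natCast]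
  by_cases hv : v ∈ S
  · rw [if_pos hv, ← h.degree_left v hv, ← hsum, Finset.sum_mul]
    refine Finset.sum_congr rfl fun w _ => ?_
    by_cases hw : w ∈ S
    · simp [h.adjMatrix_eq_zero v w (by simp [hv, hw])]
    · simp [hw]
  · rw [if_neg hv, ← h.degree_right v ((h.notMem_left_iff v).1 hv), ← hsum, Finset.sum_mul]
    refine Finset.sum_congr rfl fun w _ => ?_
    by_cases hw : w ∈ S
    · simp [hw]
    · simp [h.adjMatrix_eq_zero v w (by simp [hv, hw])]

theorem right_degree_pos (h : G.IsSemiregularBipartite S T p q) (hp : 0 < p) : 0 < q := by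
  obtain ⟨v, hv⟩ := h.left_nonempty
  have h1 := G.sum_adjMatrix v
  rw [h.degree_left v hv] at h1
  have h2 : ∑ w, G.adjMatrix v w ≠ 0 := by rw [h1]; exact_mod_cast hp.ne'
  obtain ⟨w, -, hw⟩ := Finset.exists_ne_zero_of_sum_ne_zero h2
  have hwT : w ∈ T := by
    rw [← h.notMem_left_iff]
    exact fun hS => hw (h.adjMatrix_eq_zero v w (by simp [hv, hS]))
  have h3 := G.sum_adjMatrix w
  rw [h.degree_right w hwT] at h3
  have h4 : G.adjMatrix w v ≤ ∑ x, G.adjMatrix w x :=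
    Finset.single_le_sum (fun x _ => G.adjMatrix_nonneg w x) (Finset.mem_univ v)
  have h5 : 0 < G.adjMatrix w v := by
    rw [G.adjMatrix_isSymm.apply]
    exact lt_of_le_of_ne (G.adjMatrix_nonneg v w) (Ne.symm hw)
  have h6 : (0 : ℝ) < q := by rw [← h3]; linarith
  exact_mod_cast h6

/-- The largest eigenvalue is `√(p q)`. -/
theorem one_le_and_largest (h : G.IsSemiregularBipartite S T p q) (hp : 0 < p) {k : ℕ}
    {lam : ℕ → ℝ} (hlam : ArePositiveEigenvalues G.adjMatrix k lam) :
    1 ≤ k ∧ lam 1 ^ 2 = p * q := by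
  have hq := h.right_degree_pos hp
  obtain ⟨hanti, hroots⟩ := hlam
  have hp' : (0 : ℝ) < p := by exact_mod_cast hp
  have hq' : (0 : ℝ) < q := by exact_mod_cast hq
  -- The Perron vector: on `S`, for instance, `p √q = √(p q) √p`.
  set f : V → ℝ := fun v => if v ∈ S then √(p : ℝ) else √(q : ℝ) with hf
  have hfpos : ∀ v, 0 < f v := by
    intro v
    simp only [hf]
    split_ifs
    · exact Real.sqrt_pos.2 hp'
    · exact Real.sqrt_pos.2 hq'
  have hAf : G.adjMatrix *ᵥ f = √((p : ℝ) * q) • f := by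
    have := h.adjMatrix_mulVec (RingHom.id ℝ) √(p : ℝ) √(q : ℝ)
    rw [show G.adjMatrix.map (RingHom.id ℝ) = G.adjMatrix from by ext; simp] at this
    rw [this]
    ext v
    simp only [hf, Pi.smul_apply, smul_eq_mul, Real.sqrt_mul hp'.le]
    have e1 := Real.mul_self_sqrt hp'.le
    have e2 := Real.mul_self_sqrt hq'.le
    split_ifs
    · linear_combination (-√(q : ℝ)) * e1
    · linear_combination (-√(p : ℝ)) * e2
  have hmem : ∀ t, (∃ i ∈ Finset.Icc 1 k, lam i = t) ↔
      G.adjMatrix.charpoly.IsRoot t ∧ 0 < t := by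
    intro t
    rw [← Polynomial.mem_roots G.adjMatrix.charpoly_monic.ne_zero, ← Multiset.mem_filter,
      ← hroots, Multiset.mem_map]
    rfl
  have hρ : 0 < √((p : ℝ) * q) := Real.sqrt_pos.2 (mul_pos hp' hq')
  obtain ⟨v₀, -⟩ := h.left_nonempty
  obtain ⟨i, hi, hlami⟩ := (hmem √((p : ℝ) * q)).2
    ⟨isRoot_charpoly_iff_exists.2 ⟨f, fun h0 => (hfpos v₀).ne' (congrFun h0 v₀), hAf⟩, hρ⟩
  rw [Finset.mem_Icc] at hi
  have hk : 1 ≤ k := hi.1.trans hi.2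
  have h1 : √((p : ℝ) * q) ≤ lam 1 := hlami ▸ hanti ⟨le_rfl, hk⟩ hi hi.1
  obtain ⟨hr, hpos⟩ := (hmem (lam 1)).1 ⟨1, Finset.mem_Icc.2 ⟨le_rfl, hk⟩, rfl⟩
  obtain ⟨g, hg, hAg⟩ := isRoot_charpoly_iff_exists.1 hr
  have h2 := abs_le_of_nonneg_of_mulVec_eq G.adjMatrix_nonneg hfpos hAf hg hAg
  have h3 : lam 1 = √((p : ℝ) * q) := le_antisymm ((le_abs_self _).trans h2) h1
  exact ⟨hk, by rw [h3, Real.sq_sqrt (mul_pos hp' hq').le]⟩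

omit [Fintype E] in
theorem bassMatrix_eq (h : G.IsSemiregularBipartite S T p q) (ν : ℕ) (u : ℂ) :
    G.bassMatrix ν u = diagonal (fun v => if v ∈ S then 1 + ((p : ℂ) + ν - 1) * u ^ 2
      else 1 + ((q : ℂ) + ν - 1) * u ^ 2) - u • G.adjMatrix.map Complex.ofReal := by
  rw [bassMatrix]
  congr 2
  ext v
  split_ifs with hv
  · rw [h.degree_left v hv]
  · rw [h.degree_right v ((h.notMem_left_iff v).1 hv)]

/-- Each zero singular value gives a factor `x y`, and there are `T.card - k` of them; the powers of
`x` from the block determinant adjust the exponent of `x` to `S.card - k`. The factor of `lam 1` is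
split off in closed form. -/
theorem det_bassMatrix (h : G.IsSemiregularBipartite S T p q) (hp : 0 < p) {k : ℕ}
    {lam : ℕ → ℝ} (hlam : ArePositiveEigenvalues G.adjMatrix k lam) (ν : ℕ) {u x y : ℂ}
    (hx : x = 1 + ((p : ℂ) + ν - 1) * u ^ 2) (hy : y = 1 + ((q : ℂ) + ν - 1) * u ^ 2)
    (hx0 : x ≠ 0) (hy0 : y ≠ 0) :
    (G.bassMatrix ν u).det = x ^ ((S.card : ℤ) - k) * y ^ ((T.card : ℤ) - k) *
      (x * y - p * q * u ^ 2) * ∏ i ∈ Finset.Icc 2 k, (x * y - (lam i : ℂ) ^ 2 * u ^ 2) := by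
  obtain ⟨hk, hlam1⟩ := h.one_le_and_largest hp hlam
  obtain ⟨m, hm0, hcard, hfilter, hdet⟩ := exists_singular_values G.adjMatrix G.adjMatrix_isSymm
    (fun v => v ∈ S) h.adjMatrix_eq_zero
  have hcT : Fintype.card {v // ¬v ∈ S} = T.card := by
    rw [Fintype.card_subtype]
    congr 1
    ext v
    simp [h.notMem_left_iff]
  rw [hcT] at hcard
  have hd := hdet x y u
  rw [Fintype.card_coe, hcT, hx, hy, ← h.bassMatrix_eq, ← hx, ← hy] at hd
  have hf := hfilter
  rw [← hlam.2] at hf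
  have hkm : (m.filter fun t => 0 < t).card = k := by rw [← hf]; simp
  have hsplit := Multiset.filter_add_not (fun t : ℝ => 0 < t) m
  have hcard' : (m.filter fun t => ¬0 < t).card = T.card - k := by
    have := congrArg Multiset.card hsplit
    rw [Multiset.card_add, hkm, hcard] at this
    omega
  have hkT : k ≤ T.card := by
    rw [← hkm, ← hcard]; exact Multiset.card_le_card (Multiset.filter_le _ _)
  have hzero : (m.filter fun t => ¬0 < t) = Multiset.replicate (T.card - k) 0 := by
    rw [Multiset.eq_replicate]
    refine ⟨hcard', fun t ht => ?_⟩
    rw [Multiset.mem_filter] at ht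
    exact le_antisymm (not_lt.1 ht.2) (hm0 t ht.1)
  have hprod : (m.map fun t : ℝ => x * y - (t : ℂ) ^ 2 * u ^ 2).prod =
      (x * y - p * q * u ^ 2) * (∏ i ∈ Finset.Icc 2 k, (x * y - (lam i : ℂ) ^ 2 * u ^ 2)) *
        (x * y) ^ (T.card - k) := by
    rw [← hsplit, ← hf, hzero, Multiset.map_add, Multiset.prod_add, Multiset.map_map,
      Multiset.map_replicate, Multiset.prod_replicate]
    congr 1
    · have : Finset.Icc 1 k = insert 1 (Finset.Icc 2 k) :=
        (Finset.insert_Icc_succ_left_eq_Icc hk).symm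
      rw [← Finset.prod_eq_multiset_prod, this, Finset.prod_insert (by simp)]
      congr 1
      simp only [Function.comp_apply]
      rw [show ((lam 1 : ℝ) : ℂ) ^ 2 = p * q by exact_mod_cast hlam1]
    · simp
  rw [hprod] at hd
  have hxT : x ^ T.card ≠ 0 := pow_ne_zero _ hx0
  refine mul_right_cancel₀ hxT (hd.trans ?_)
  rw [zpow_sub₀ hx0, zpow_sub₀ hy0, mul_pow, pow_sub₀ x hx0 hkT, pow_sub₀ y hy0 hkT]
  simp only [zpow_natCast]
  field_simp

/-- With values `a` on `S` and `b` on `T` the system becomes `x a - u p b = 1`, `y b - u q a = 1`,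
solved by Cramer's rule. -/
theorem exists_bassMatrix_mulVec (h : G.IsSemiregularBipartite S T p q) (ν : ℕ) {u x y : ℂ}
    (hx : x = 1 + ((p : ℂ) + ν - 1) * u ^ 2) (hy : y = 1 + ((q : ℂ) + ν - 1) * u ^ 2)
    (hd : x * y - p * q * u ^ 2 ≠ 0) :
    ∃ z : V → ℂ, G.bassMatrix ν u *ᵥ z = 1 ∧
      ∑ v, z v = (S.card * (y + u * p) + T.card * (x + u * q)) / (x * y - p * q * u ^ 2) := by
  set a := (y + u * p) / (x * y - p * q * u ^ 2) with ha
  set b := (x + u * q) / (x * y - p * q * u ^ 2) with hb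
  refine ⟨fun v => if v ∈ S then a else b, ?_, ?_⟩
  · have h1 := h.adjMatrix_mulVec Complex.ofRealHom a b
    rw [h.bassMatrix_eq, ← hx, ← hy, sub_mulVec, smul_mulVec]
    change _ - u • (G.adjMatrix.map Complex.ofRealHom *ᵥ _) = 1
    rw [h1]
    ext v
    rw [Pi.sub_apply, mulVec_diagonal, Pi.smul_apply, Pi.one_apply, smul_eq_mul]
    have e1 : x * a - u * (p * b) = (x * y - p * q * u ^ 2) / (x * y - p * q * u ^ 2) := by
      rw [ha, hb]; ring
    have e2 : y * b - u * (q * a) = (x * y - p * q * u ^ 2) / (x * y - p * q * u ^ 2) := by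
      rw [ha, hb]; ring
    rw [div_self hd] at e1 e2
    split_ifs
    · exact e1
    · exact e2
  · rw [← h.union_eq, Finset.sum_union h.disjoint,
      Finset.sum_congr rfl fun v hv => if_pos hv,
      Finset.sum_congr rfl fun v hv => if_neg ((h.notMem_left_iff v).2 hv)]
    simp only [Finset.sum_const, nsmul_eq_mul]
    rw [ha, hb]
    ring

end IsSemiregularBipartite

end Multigraph

/-! ### The zeta function of the join. -/

theorem theorem3p2
    {V₁ E₁ V₂ E₂ : Type*} [Fintype V₁] [DecidableEq V₁] [Fintype E₁]
    [Fintype V₂] [DecidableEq V₂] [Fintype E₂]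
    (G₁ : Multigraph V₁ E₁) (G₂ : Multigraph V₂ E₂)
    (S₁ S₂ : Finset V₁) (S₃ S₄ : Finset V₂) (q₁ q₂ q₃ q₄ : ℕ)
    (hG₁ : G₁.IsSemiregularBipartite S₁ S₂ q₁ q₂)
    (hG₂ : G₂.IsSemiregularBipartite S₃ S₄ q₃ q₄)
    (hq₁ : 0 < q₁) (hq₃ : 0 < q₃)
    (k₁ k₂ : ℕ) (lam mu : ℕ → ℝ)
    (hlam : Multigraph.ArePositiveEigenvalues G₁.adjMatrix k₁ lam)
    (hmu : Multigraph.ArePositiveEigenvalues G₂.adjMatrix k₂ mu)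
    (n₁ n₂ n₃ n₄ ν₁ ν₂ ε₁ ε₂ : ℕ)
    (hn₁ : n₁ = S₁.card) (hn₂ : n₂ = S₂.card) (hn₃ : n₃ = S₃.card) (hn₄ : n₄ = S₄.card)
    (hν₁ : ν₁ = n₁ + n₂) (hν₂ : ν₂ = n₃ + n₄)
    (hε₁ : ε₁ = n₁ * q₁) (hε₂ : ε₂ = n₃ * q₃)
    (x₁ x₂ x₃ x₄ a₁ a₂ h : ℂ → ℂ)
    (hx₁ : ∀ u, x₁ u = 1 + ((q₁ : ℂ) + ν₂ - 1) * u ^ 2)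
    (hx₂ : ∀ u, x₂ u = 1 + ((q₂ : ℂ) + ν₂ - 1) * u ^ 2)
    (hx₃ : ∀ u, x₃ u = 1 + ((q₃ : ℂ) + ν₁ - 1) * u ^ 2)
    (hx₄ : ∀ u, x₄ u = 1 + ((q₄ : ℂ) + ν₁ - 1) * u ^ 2)
    (ha₁ : ∀ u, a₁ u = (n₃ * (x₄ u + u * q₃) + n₄ * (x₃ u + u * q₄))
      / (x₃ u * x₄ u - q₃ * q₄ * u ^ 2))
    (ha₂ : ∀ u, a₂ u = (n₁ * (x₂ u + u * q₁) + n₂ * (x₁ u + u * q₂))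
      / (x₁ u * x₂ u - q₁ * q₂ * u ^ 2))
    (hh : ∀ u, h u = (1 - a₁ u * a₂ u * u ^ 2) * (x₁ u * x₂ u - q₁ * q₂ * u ^ 2)
      * (x₃ u * x₄ u - q₃ * q₄ * u ^ 2)) :
    ∃ r : ℝ, 0 < r ∧ ∀ u : ℂ, ‖u‖ < r →
      x₁ u * x₂ u - q₁ * q₂ * u ^ 2 ≠ 0 ∧ x₃ u * x₄ u - q₃ * q₄ * u ^ 2 ≠ 0 ∧
      Multipliable ((G₁.join G₂).eulerFactor u) ∧ (G₁.join G₂).iharaZeta u ≠ 0 ∧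
      ((G₁.join G₂).iharaZeta u)⁻¹ =
        (1 - u ^ 2) ^ ((ε₁ : ℤ) + ε₂ + ν₁ * ν₂ - ν₁ - ν₂)
          * x₁ u ^ ((n₁ : ℤ) - k₁) * x₂ u ^ ((n₂ : ℤ) - k₁)
          * x₃ u ^ ((n₃ : ℤ) - k₂) * x₄ u ^ ((n₄ : ℤ) - k₂)
          * h u
          * (∏ i ∈ Finset.Icc 2 k₁, (x₁ u * x₂ u - (lam i : ℂ) ^ 2 * u ^ 2))
          * (∏ j ∈ Finset.Icc 2 k₂, (x₃ u * x₄ u - (mu j : ℂ) ^ 2 * u ^ 2)) := by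
  subst hn₁ hn₂ hn₃ hn₄ hν₁ hν₂ hε₁ hε₂
  have hcont : ∀ (c : ℂ), Continuous fun u : ℂ => 1 + c * u ^ 2 := fun c => by fun_prop
  have hx₁' := funext hx₁
  have hx₂' := funext hx₂
  have hx₃' := funext hx₃
  have hx₄' := funext hx₄
  have hne : ∀ f : ℂ → ℂ, Continuous f → f 0 ≠ 0 → ∀ᶠ u in nhds 0, f u ≠ 0 :=
    fun f hf h0 => (hf.tendsto 0).eventually_ne h0
  have e₁ := hne x₁ (hx₁' ▸ hcont _) (by simp [hx₁])
  have e₂ := hne x₂ (hx₂' ▸ hcont _) (by simp [hx₂])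
  have e₃ := hne x₃ (hx₃' ▸ hcont _) (by simp [hx₃])
  have e₄ := hne x₄ (hx₄' ▸ hcont _) (by simp [hx₄])
  have e₅ := hne (fun u => x₁ u * x₂ u - q₁ * q₂ * u ^ 2) (by rw [hx₁', hx₂']; fun_prop)
    (by simp [hx₁, hx₂])
  have e₆ := hne (fun u => x₃ u * x₄ u - q₃ * q₄ * u ^ 2) (by rw [hx₃', hx₄']; fun_prop)
    (by simp [hx₃, hx₄])
  have e₇ := (G₁.join G₂).eventually_hasProd_eulerFactor
  have e₈ := (G₁.join G₂).eventually_iharaZeta_ne_zero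
  -- Finitely many conditions valid near `0` hold on a common ball, whose radius is `r`.
  have key := (e₁.and (e₂.and (e₃.and (e₄.and (e₅.and (e₆.and (e₇.and e₈)))))))
  obtain ⟨r, hr, hball⟩ := Metric.eventually_nhds_iff.1 key
  refine ⟨r, hr, fun u hu => ?_⟩
  obtain ⟨h₁, h₂, h₃, h₄, h₅, h₆, h₇, h₈⟩ := hball (by simpa using hu)
  refine ⟨h₅, h₆, h₇.multipliable, h₈, ?_⟩
  have hc₁ := hG₁.card_vertices
  have hc₂ := hG₂.card_vertices
  rw [Multigraph.iharaZeta, h₇.tprod_eq, inv_inv, Multigraph.bassMatrix_join]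
  obtain ⟨y, hy, hysum⟩ := hG₁.exists_bassMatrix_mulVec (Fintype.card V₂) (u := u)
    (by rw [hx₁, hc₂]) (by rw [hx₂, hc₂]) h₅
  obtain ⟨z, hz, hzsum⟩ := hG₂.exists_bassMatrix_mulVec (Fintype.card V₁) (u := u)
    (by rw [hx₃, hc₁]) (by rw [hx₄, hc₁]) h₆
  -- The indices cross: the entry sum for `G₁` is `a₂` and that for `G₂` is `a₁`.
  rw [Matrix.det_fromBlocks_const hy hz, hysum, hzsum, ← ha₁, ← ha₂,
    hG₁.det_bassMatrix hq₁ hlam _ (by rw [hx₁, hc₂]) (by rw [hx₂, hc₂]) h₁ h₂,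
    hG₂.det_bassMatrix hq₃ hmu _ (by rw [hx₃, hc₁]) (by rw [hx₄, hc₁]) h₃ h₄, hh]
  have hexp : ((Fintype.card (E₁ ⊕ E₂ ⊕ V₁ × V₂) : ℕ) : ℤ) - (Fintype.card (V₁ ⊕ V₂) : ℕ) =
      ((S₁.card * q₁ : ℕ) : ℤ) + (S₃.card * q₃ : ℕ) + ((S₁.card + S₂.card : ℕ) : ℤ)
        * (S₃.card + S₄.card : ℕ) - (S₁.card + S₂.card : ℕ) - (S₃.card + S₄.card : ℕ) := by
    simp only [Fintype.card_sum, Fintype.card_prod, hG₁.card_edges, hG₂.card_edges, hc₁, hc₂]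
    push_cast
    ring
  rw [hexp]
  ring
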